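/- Let $(T,\mu)$ be a probability space and $t_0>0$. Let $\nu$ be a locally finite Borel measure on $\mathbb{R}$ and let $\kappa:T\times[0,t_0]\to\mathbb{R}$, $\kappa_\tau(t)=\kappa(\tau,t)$, be jointly measurable. For a measurable function $k:[0,t_0]\to\mathbb R$, a *stopped solution* of the Jacobi equation $j''=k\,\nu\, j$ with standard initial conditions $j(0)=0$, $j'(0)=1$ is a function $j:[0,t_0]\to[0,\infty)$ for which there is $b\in(0,t_0]$ such that: $kj$ is $\nu$-integrable on $[0,b]$; $j(t)=\int_0^t v(u)\,du$ with $v(t)=1+\int_{[0,t]}k(u)j(u)\,d\nu(u)$ for $t\in[0,b]$; $j>0$ on $(0,b)$; $b=t_0$ or $j(b)=0$; and $j=0$ on $(b,t_0]$. (For $\nu$ Lebesgue measure this is the equation $j''(t)=k(t)j(t)$, with the solution held at zero after its first positive zero; general $\nu$ allows coefficients that are measures, such as Dirac impulses.) Let $\sigma:T\times[0,t_0]\to T$, $\sigma_t(\tau)=\sigma(\tau,t)$, be jointly measurable, with each $\sigma_t$ preserving $\mu$ (for instance a measure automorphism of $T$) and $\sigma_0=\mathrm{id}$. Let $j^0_\tau$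 and $j^\sigma_\tau$ be, for almost every $\tau\in T$, stopped solutions with coefficients $t\mapsto\kappa_\tau(t)$ and $t\mapsto\kappa_{\sigma_t(\tau)}(t)$ respectively (the existence of these solutions is assumed). Suppose the family is monotone: for all $\tau,\tau'\in T$, if $\kappa_\tau(s)>\kappa_{\tau'}(s)$ for some $s\in[0,t_0]$, then $\kappa_\tau(s)\ge\kappa_{\tau'}(s)$ for all $s\in[0,t_0]$. Then for all $s\in[0,t_0]$ and all real $p\ge1$, $$\int_T j^\sigma_\tau(s)^p\,d\mu(\tau)\ \le\ \int_T j^0_\tau(s)^p\,d\mu(\tau)\qquad\text{in }[0,\infty].$$ In particular (with $\nu$ Lebesgue measure), if $c:T\to\mathbb{R}$ is measurable, $j^0_\tau$ is the stopped solution of the constant-coefficient equation $j''=c(\tau)\,j$ and $j^\sigma_\tau$ that of $j''(t)=c(\sigma_t(\tau))\,j(t)$, for almost every $\tau$, then the same inequality holds for all $s\in[0,t_0]$ and all real $p\ge1$: the integrals are maximized by leaving the coefficients constant. -/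

import Mathlib

open MeasureTheory Set

noncomputable section

namespace JacobiShuffle

/-- `j`, with first derivative `v`, solves the Jacobi equation `j'' = κ j`, `j 0 = 0`, `j' 0 = 1`
on `[0, b]`, where the coefficient is the (signed) measure `κ = k · ν` with density `k` with respect
to the reference measure `ν`. For `ν = volume` the coefficient is the measurable function `k`, and
this is the usual (Carathéodory) notion of solution; for `ν` with atoms it allows Dirac impulses,
at which the (right-continuous) velocity `v` jumps by `k t * j t * ν {t}`. -/
structure SolvesJacobi (ν : Measure ℝ) (k : ℝ → ℝ) (b : ℝ) (j v : ℝ → ℝ) : Prop where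
  integrable : IntegrableOn (fun u => k u * j u) (Icc 0 b) ν
  velocity : ∀ t ∈ Icc 0 b, v t = 1 + ∫ u in Icc 0 t, k u * j u ∂ν
  position : ∀ t ∈ Icc 0 b, j t = ∫ u in (0 : ℝ)..t, v u

/-- `j` is the solution on `[0, t₀]` of the Jacobi equation with coefficient `k · ν` and standard
initial conditions, stopped at zero: it evolves by the equation up to its first positive zero `b`
(or up to `t₀`, if there is no zero before `t₀`) and vanishes from then on. -/
def IsStoppedSolution (ν : Measure ℝ) (k : ℝ → ℝ) (t₀ : ℝ) (j : ℝ → ℝ) : Prop :=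
  ∃ b ∈ Ioc 0 t₀, (∃ v : ℝ → ℝ, SolvesJacobi ν k b j v) ∧
    (∀ t ∈ Ioo 0 b, 0 < j t) ∧ (b = t₀ ∨ j b = 0) ∧ ∀ t ∈ Ioc b t₀, j t = 0

variable {T : Type*}

/-- A family of coefficients is monotone on `[0, t₀]` if any two of its members are ordered the
same way at all times. -/
def IsMonotoneFamily (t₀ : ℝ) (k : T → ℝ → ℝ) : Prop :=
  ∀ τ τ' : T, (∃ s ∈ Icc 0 t₀, k τ' s < k τ s) → ∀ s ∈ Icc 0 t₀, k τ' s ≤ k τ s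

/-- The shuffled coefficients `κ_{σ(t) τ}(t)`. -/
def shuffled (σ : ℝ → T → T) (k : T → ℝ → ℝ) : T → ℝ → ℝ :=
  fun τ t => k (σ t τ) t

variable [MeasurableSpace T]

/-- A time-dependent measurable family of measure-preserving maps of `T`, starting at the identity.
(Invertibility is not required.) -/
structure IsShuffle (μ : Measure T) (t₀ : ℝ) (σ : ℝ → T → T) : Prop where
  measurable : Measurable (fun x : T × ℝ => σ x.2 x.1)
  preserving : ∀ t ∈ Icc 0 t₀, MeasurePreserving (σ t) μ μ
  initial : σ 0 = id

/-- `j τ` is the stopped solution of the Jacobi equation with coefficient `k τ · ν`, for almost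
every `τ`. -/
def IsSolutionFamily (μ : Measure T) (ν : Measure ℝ) (t₀ : ℝ) (k j : T → ℝ → ℝ) : Prop :=
  ∀ᵐ τ ∂μ, IsStoppedSolution ν (k τ) t₀ (j τ)

/-- The total solution `∫_T j_τ(s)^p`, the integral of a nonnegative function, in `[0, ∞]`. -/
def Tot (μ : Measure T) (s p : ℝ) (j : T → ℝ → ℝ) : ENNReal :=
  ∫⁻ τ, ENNReal.ofReal (j τ s ^ p) ∂μ

end JacobiShuffle

end

/-! The stopped solution becomes, after division by a fixed positive solution `h` with coefficient
`γ`, comparable to a series with nonnegative terms. By the Wronskian identity the ratio `z = j / h`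
satisfies the Volterra equation `z t = 1 + ∫ K t u * (k u - γ u) * z u`, with kernel `K t u = h(u)²
∫_u^t h⁻²`. Replacing `k - γ` by its positive part and iterating gives the Neumann series, whose
terms arise from the constant `1` by repeatedly multiplying by the coefficient and integrating
against a positive kernel.

A monotone family is ordered at all times by one real rank. Hence every unshuffled factor is
increasing in that same rank, and each shuffled factor is a rearrangement of it. A Hardy–Littlewood
type argument shows that the relation "weakly majorized, with the larger function arranged along the
rank" survives such multiplications (`RearrLE.mul_comp`), as well as integrals and sums, and that it
implies the inequality of `p`-th moments (`RearrLE.lintegral_rpow_le`). So the moments of the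
shuffled Neumann series are at most those of the unshuffled one (`lintegral_neumann_rpow_le`).

The series always bounds a stopped solution from above (`StoppedAt.le_tsum`), which suits the
shuffled side. On the unshuffled side an upper bound on the series is needed: it is at most the
ratio itself when the solution is positive and `γ ≤ k` (`IsLive.tsum_le`), but equals `1` when `k ≤
γ`. Members that die before time `s` therefore cost an error `h(s)^p`. `StoppedAt.exists_between`
produces bases `γ` above a given dead member and below a given live one with `h(s)` arbitrarily
small. With dead and live members exhausting the two sides of the threshold, all errors vanish in
the limit (`RankedShuffle.tot_le_of_live`).

If no solution of the family survives to time `s`, there is no base to start from, and it is shown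
directly that almost no shuffled solution survives (`RankedShuffle.ae_eq_zero_of_dead`): the
coefficient of a survivor could be lowered slightly, keeping a positive solution, until it lies
below a member of the family, contradicting Sturm comparison. -/

open MeasureTheory Set Filter Topology
open scoped ENNReal

noncomputable section

namespace JacobiShuffle

/-! ### Weak majorization along a rank. -/

section Rearrangement

variable {T : Type*}

/-- A weight `w : T → [0, 1]` that only depends on the rank `r`, is `1` above some level of `r`
and `0` below it. -/
structure IsThreshold [MeasurableSpace T] (r : T → ℝ) (w : T → ℝ≥0∞) : Prop where
  measurable : Measurable w
  le_one : ∀ τ, w τ ≤ 1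
  congr : ∀ τ τ', r τ = r τ' → w τ = w τ'
  eq_one : ∀ τ τ', r τ < r τ' → w τ ≠ 0 → w τ' = 1

variable [MeasurableSpace T] {μ : Measure T} {r : T → ℝ}

/-- The level is the infimum of those `x` with `μ {x < r} ≤ m`. Continuity of `μ` along levels
decreasing to it gives the first bound, and along levels increasing to it the second. -/
lemma exists_quantile [IsProbabilityMeasure μ] (hr : Measurable r) {m : ℝ≥0∞}
    (h0 : 0 < m) (h1 : m < 1) : ∃ c : ℝ, μ {τ | c < r τ} ≤ m ∧ m ≤ μ {τ | c ≤ r τ} := by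
  have hanti : ∀ x y : ℝ, x ≤ y → μ {τ | y < r τ} ≤ μ {τ | x < r τ} := fun x y h =>
    measure_mono fun τ hτ => lt_of_le_of_lt h hτ
  set S : Set ℝ := {x | μ {τ | x < r τ} ≤ m} with hS
  have hne : S.Nonempty := by
    have ht := tendsto_measure_iInter_atTop (μ := μ) (s := fun n : ℕ => {τ | (n : ℝ) < r τ})
      (fun n => (measurableSet_lt measurable_const hr).nullMeasurableSet)
      (fun a b hab τ hτ => by
        have := (Nat.cast_le (α := ℝ)).2 hab
        simp only [mem_ofPred_eq] at hτ ⊢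
        linarith) ⟨0, measure_ne_top _ _⟩
    have he : (⋂ n : ℕ, {τ | (n : ℝ) < r τ}) = ∅ := by
      ext τ
      simp only [mem_iInter, mem_ofPred_eq, mem_empty_iff_false, iff_false, not_forall, not_lt]
      exact exists_nat_ge (r τ)
    rw [he, measure_empty] at ht
    obtain ⟨n, hn⟩ := (ht.eventually (gt_mem_nhds h0)).exists
    exact ⟨n, hn.le⟩
  have hbdd : BddBelow S := by
    have ht := tendsto_measure_iUnion_atTop (μ := μ) (s := fun n : ℕ => {τ | -(n : ℝ) < r τ})
      (fun a b hab τ hτ => by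
        have := (Nat.cast_le (α := ℝ)).2 hab
        simp only [mem_ofPred_eq] at hτ ⊢
        linarith)
    have he : (⋃ n : ℕ, {τ | -(n : ℝ) < r τ}) = univ := by
      ext τ
      simp only [mem_iUnion, mem_ofPred_eq, mem_univ, iff_true]
      obtain ⟨n, hn⟩ := exists_nat_gt (-r τ)
      exact ⟨n, by linarith⟩
    rw [he, measure_univ] at ht
    obtain ⟨n, hn⟩ := (ht.eventually (lt_mem_nhds h1)).exists
    refine ⟨-(n : ℝ), fun x hx => ?_⟩
    by_contra hlt
    exact absurd (hn.trans_le (hanti _ _ (not_le.1 hlt).le)) (not_lt.2 hx)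
  refine ⟨sInf S, ?_, ?_⟩
  · have he : {τ | sInf S < r τ} = ⋃ n : ℕ, {τ | sInf S + 1 / ((n : ℝ) + 1) < r τ} := by
      ext τ
      simp only [mem_ofPred_eq, mem_iUnion]
      constructor
      · intro h
        obtain ⟨n, hn⟩ := exists_nat_one_div_lt (sub_pos.2 h)
        exact ⟨n, by linarith⟩
      · rintro ⟨n, hn⟩
        have : (0 : ℝ) < 1 / ((n : ℝ) + 1) := by positivity
        linarith
    have ht := tendsto_measure_iUnion_atTop (μ := μ)
      (s := fun n : ℕ => {τ | sInf S + 1 / ((n : ℝ) + 1) < r τ})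
      (fun a b hab τ hτ => by
        have := Nat.one_div_le_one_div (α := ℝ) hab
        simp only [mem_ofPred_eq] at hτ ⊢
        linarith)
    rw [← he] at ht
    refine le_of_tendsto' ht fun n => ?_
    have hp : (0 : ℝ) < 1 / ((n : ℝ) + 1) := by positivity
    obtain ⟨x, hx, hxl⟩ := exists_lt_of_csInf_lt hne (lt_add_of_pos_right (sInf S) hp)
    exact (hanti _ _ hxl.le).trans hx
  · have he : {τ | sInf S ≤ r τ} = ⋂ n : ℕ, {τ | sInf S - 1 / ((n : ℝ) + 1) < r τ} := by
      ext τ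
      simp only [mem_ofPred_eq, mem_iInter]
      constructor
      · intro h n
        have : (0 : ℝ) < 1 / ((n : ℝ) + 1) := by positivity
        linarith
      · intro h
        by_contra hlt
        obtain ⟨n, hn⟩ := exists_nat_one_div_lt (sub_pos.2 (not_le.1 hlt))
        linarith [h n]
    have ht := tendsto_measure_iInter_atTop (μ := μ)
      (s := fun n : ℕ => {τ | sInf S - 1 / ((n : ℝ) + 1) < r τ})
      (fun n => (measurableSet_lt measurable_const hr).nullMeasurableSet)
      (fun a b hab τ hτ => by
        have := Nat.one_div_le_one_div (α := ℝ) hab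
        simp only [mem_ofPred_eq] at hτ ⊢
        linarith) ⟨0, measure_ne_top _ _⟩
    rw [← he] at ht
    refine ge_of_tendsto' ht fun n => ?_
    have hp : (0 : ℝ) < 1 / ((n : ℝ) + 1) := by positivity
    have hnm : sInf S - 1 / ((n : ℝ) + 1) ∉ S := notMem_of_lt_csInf (by linarith) hbdd
    exact (not_le.1 hnm).le

/-- Superlevel sets need not attain every measure, since a level set of `r` may have positive mass.
Allowing a fractional weight on that level set removes the obstruction. -/
lemma exists_isThreshold [IsProbabilityMeasure μ] (hr : Measurable r) {m : ℝ≥0∞} (h1 : m ≤ 1) :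
    ∃ w, IsThreshold r w ∧ ∫⁻ τ, w τ ∂μ = m := by
  rcases eq_or_ne m 0 with rfl | h0
  · exact ⟨fun _ => 0, ⟨measurable_const, by simp, by simp, by simp⟩, by simp⟩
  rcases eq_or_lt_of_le h1 with rfl | h1
  · exact ⟨fun _ => 1, ⟨measurable_const, by simp, by simp, by simp⟩, by simp⟩
  obtain ⟨c, hc1, hc2⟩ := exists_quantile (μ := μ) hr (pos_iff_ne_zero.2 h0) h1
  set A : Set T := {τ | c < r τ}
  set B : Set T := {τ | r τ = c}
  have hA : MeasurableSet A := measurableSet_lt measurable_const hr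
  have hB : MeasurableSet B := measurableSet_eq_fun hr measurable_const
  have hd : Disjoint A B := by
    rw [Set.disjoint_left]
    intro τ h1 h2
    exact absurd h2 (ne_of_gt h1)
  have hAB : {τ | c ≤ r τ} = A ∪ B := by
    ext τ
    simp only [A, B, mem_ofPred_eq, mem_union]
    rw [le_iff_lt_or_eq, eq_comm (a := c)]
  rw [hAB, measure_union hd hB] at hc2
  -- The fraction of the critical level set needed to fill the mass up to `m`.
  set α : ℝ≥0∞ := (m - μ A) / μ B with hα
  have hαB : α * μ B = m - μ A := by
    rcases eq_or_ne (μ B) 0 with h | h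
    · rw [h, mul_zero]
      rw [h, add_zero] at hc2
      exact (tsub_eq_zero_of_le hc2).symm
    · exact ENNReal.div_mul_cancel h (measure_ne_top _ _)
  have hα1 : α ≤ 1 := by
    refine ENNReal.div_le_of_le_mul ?_
    rw [one_mul]
    exact tsub_le_iff_left.2 hc2
  refine ⟨fun τ => A.indicator 1 τ + B.indicator (fun _ => α) τ, ⟨?_, ?_, ?_, ?_⟩, ?_⟩
  · exact (measurable_one.indicator hA).add (measurable_const.indicator hB)
  · intro τ
    by_cases h : τ ∈ A
    · have : τ ∉ B := Set.disjoint_left.1 hd h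
      simp [h, this]
    · by_cases h' : τ ∈ B <;> simp [h, h', hα1]
  · intro τ τ' h
    have h1 : τ ∈ A ↔ τ' ∈ A := by simp [A, h]
    have h2 : τ ∈ B ↔ τ' ∈ B := by simp [B, h]
    simp only [indicator, h1, h2, Pi.one_apply]
  · intro τ τ' h hw
    have : c ≤ r τ := by
      by_contra hlt
      have h1 : τ ∉ A := fun h => hlt (le_of_lt h)
      have h2 : τ ∉ B := fun h => hlt (ge_of_eq h)
      simp [h1, h2] at hw
    have h1 : τ' ∈ A := lt_of_le_of_lt this h
    have h2 : τ' ∉ B := Set.disjoint_left.1 hd h1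
    simp [h1, h2]
  · rw [lintegral_add_left (measurable_one.indicator hA), lintegral_indicator_one hA,
      lintegral_indicator_const hB, hαB]
    exact add_tsub_cancel_of_le hc1

/-- Two thresholds for the same rank are pointwise comparable as whole functions, so their masses
decide the order. If `w < w'` at one point, then `w ≤ w'` everywhere, and the masses force equality
almost everywhere. -/
lemma IsThreshold.ae_le {w w' : T → ℝ≥0∞} (hw : IsThreshold r w)
    (hw' : IsThreshold r w') (hfin : ∫⁻ τ, w τ ∂μ ≠ ∞) (h : ∫⁻ τ, w' τ ∂μ ≤ ∫⁻ τ, w τ ∂μ) :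
    w' ≤ᵐ[μ] w := by
  by_cases hB : ∃ τ, w τ < w' τ
  · obtain ⟨τ, hτ⟩ := hB
    have hle : w ≤ w' := by
      intro τ'
      rcases lt_trichotomy (r τ) (r τ') with h1 | h1 | h1
      · rw [hw'.eq_one τ τ' h1 (ne_bot_of_gt hτ)]
        exact hw.le_one _
      · rw [← hw.congr _ _ h1, ← hw'.congr _ _ h1]
        exact hτ.le
      · by_contra hlt
        have h0 : w τ' ≠ 0 := ne_bot_of_gt (not_le.1 hlt)
        have := hw.eq_one τ' τ h1 h0
        rw [this] at hτ
        exact absurd (hw'.le_one τ) (not_le.2 hτ)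
    exact (ae_eq_of_ae_le_of_lintegral_le (Filter.Eventually.of_forall hle) hfin
      hw'.measurable.aemeasurable h).symm.le
  · push Not at hB
    exact Filter.Eventually.of_forall hB

/-- `V` is an upper set for the rank only up to null pairs. If `w` charged the complement of `V`,
some typical point there would have smaller rank than almost all of `V`, forcing `w = 1` on `V` and
giving `w` more mass than `V`. -/
lemma IsThreshold.ae_le_indicator [IsFiniteMeasure μ] {w : T → ℝ≥0∞}
    (hw : IsThreshold r w) {V : Set T} (hV : MeasurableSet V)
    (hup : ∀ᵐ x ∂μ.prod μ, x.1 ∉ V → x.2 ∈ V → r x.1 < r x.2) (h : ∫⁻ τ, w τ ∂μ ≤ μ V) :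
    w ≤ᵐ[μ] V.indicator 1 := by
  set B : Set T := {τ | τ ∉ V ∧ w τ ≠ 0}
  have hB : MeasurableSet B :=
    hV.compl.inter (hw.measurable (measurableSet_singleton (0 : ℝ≥0∞)).compl)
  suffices hB0 : μ B = 0 by
    have : ∀ᵐ τ ∂μ, τ ∉ B := measure_eq_zero_iff_ae_notMem.1 hB0
    filter_upwards [this] with τ hτ
    by_cases hτV : τ ∈ V
    · simpa [hτV] using hw.le_one τ
    · have : w τ = 0 := by
        by_contra h0
        exact hτ ⟨hτV, h0⟩
      simp [this]
  by_contra hB0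
  obtain ⟨τ, hτB, hτ⟩ : ∃ τ ∈ B, ∀ᵐ τ' ∂μ, τ ∉ V → τ' ∈ V → r τ < r τ' := by
    by_contra hcon
    apply hB0
    rw [measure_eq_zero_iff_ae_notMem]
    filter_upwards [Measure.ae_ae_of_ae_prod hup] with τ hτ hτB
    exact hcon ⟨τ, hτB, hτ⟩
  have hle : ∀ᵐ τ' ∂μ, V.indicator 1 τ' + B.indicator w τ' ≤ w τ' := by
    filter_upwards [hτ] with τ' hτ'
    by_cases h' : τ' ∈ V
    · have : τ' ∉ B := fun hh => hh.1 h'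
      simp [h', this, hw.eq_one τ τ' (hτ' hτB.1 h') hτB.2]
    · by_cases h'' : τ' ∈ B <;> simp [h', h'']
  have h1 := lintegral_mono_ae hle
  rw [lintegral_add_left (measurable_one.indicator hV), lintegral_indicator_one hV] at h1
  have h2 : ∫⁻ τ', B.indicator w τ' ∂μ = 0 := by
    have h3 : μ V + ∫⁻ τ', B.indicator w τ' ∂μ ≤ μ V + 0 := by
      rw [add_zero]
      exact h1.trans h
    simpa using (ENNReal.add_le_add_iff_left (measure_ne_top μ V)).1 h3
  rw [lintegral_eq_zero_iff (hw.measurable.indicator hB)] at h2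
  apply hB0
  rw [measure_eq_zero_iff_ae_notMem]
  filter_upwards [h2] with τ' hτ' hB'
  rw [indicator_of_mem hB'] at hτ'
  exact hB'.2 hτ'

/-- `f` is weakly majorized by `g`, when `g` is arranged along the rank `r`: the integral of `f`
over any set is at most the integral of `g` over a top set for `r` of the same measure. -/
def RearrLE (μ : Measure T) (r : T → ℝ) (f g : T → ℝ≥0∞) : Prop :=
  ∀ E, MeasurableSet E → ∀ w, IsThreshold r w → ∫⁻ τ, w τ ∂μ = μ E →
    ∫⁻ τ in E, f τ ∂μ ≤ ∫⁻ τ, w τ * g τ ∂μ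

lemma RearrLE.one : RearrLE μ r (fun _ => 1) (fun _ => 1) := by
  intro E hE w hw h
  simp [h]

lemma ofReal_eq_lintegral_lt (x : ℝ) :
    ENNReal.ofReal x = ∫⁻ a in Ioi (0 : ℝ), (Iio x).indicator 1 a := by
  rw [lintegral_indicator_one measurableSet_Iio, Measure.restrict_apply measurableSet_Iio,
    inter_comm, Ioi_inter_Iio, Real.volume_Ioo, sub_zero]

/-- The Hardy–Littlewood step. The layer-cake formula reduces the factor `q` to indicators of its
superlevel sets `V`; then only the mass of `E ∩ φ ⁻¹' V` matters, and it is at most both `μ E` and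
`μ V`. -/
lemma RearrLE.mul_comp [IsProbabilityMeasure μ] {f g : T → ℝ≥0∞} (h : RearrLE μ r f g)
    (hr : Measurable r) (hf : Measurable f) (hg : Measurable g) {q : T → ℝ} (hq : Measurable q)
    (hmono : ∀ᵐ x ∂μ.prod μ, r x.2 ≤ r x.1 → q x.2 ≤ q x.1) {φ : T → T}
    (hφ : MeasurePreserving φ μ μ) :
    RearrLE μ r (fun τ => ENNReal.ofReal (q (φ τ)) * f τ)
      (fun τ => ENNReal.ofReal (q τ) * g τ) := by
  intro E hE w hw hwE
  have hset : MeasurableSet {x : T × ℝ | x.2 < q x.1} :=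
    measurableSet_lt measurable_snd (hq.comp measurable_fst)
  have hset' : MeasurableSet {x : T × ℝ | x.2 < q (φ x.1)} :=
    measurableSet_lt measurable_snd (hq.comp (hφ.measurable.comp measurable_fst))
  have e1 : ∀ τ a, (Iio (q (φ τ))).indicator (1 : ℝ → ℝ≥0∞) a * f τ
      = {x : T × ℝ | x.2 < q (φ x.1)}.indicator (fun x => f x.1) (τ, a) := by
    intro τ a
    by_cases h : a < q (φ τ) <;> simp [h]
  have e2 : ∀ τ a, w τ * ((Iio (q τ)).indicator (1 : ℝ → ℝ≥0∞) a * g τ)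
      = {x : T × ℝ | x.2 < q x.1}.indicator (fun x => w x.1 * g x.1) (τ, a) := by
    intro τ a
    by_cases h : a < q τ <;> simp [h]
  calc ∫⁻ τ in E, ENNReal.ofReal (q (φ τ)) * f τ ∂μ
      = ∫⁻ τ in E, ∫⁻ a in Ioi (0 : ℝ),
          {x : T × ℝ | x.2 < q (φ x.1)}.indicator (fun x => f x.1) (τ, a) ∂volume ∂μ := by
        refine lintegral_congr fun τ => ?_
        rw [ofReal_eq_lintegral_lt, ← lintegral_mul_const _
          (measurable_one.indicator measurableSet_Iio)]
        exact lintegral_congr fun a => e1 τ a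
    _ = ∫⁻ a in Ioi (0 : ℝ), ∫⁻ τ in E,
          {x : T × ℝ | x.2 < q (φ x.1)}.indicator (fun x => f x.1) (τ, a) ∂μ := by
        rw [lintegral_lintegral_swap]
        exact ((hf.comp measurable_fst).indicator hset').aemeasurable
    _ ≤ ∫⁻ a in Ioi (0 : ℝ), ∫⁻ τ,
          {x : T × ℝ | x.2 < q x.1}.indicator (fun x => w x.1 * g x.1) (τ, a) ∂μ := by
        refine lintegral_mono fun a => ?_
        set V : Set T := {τ | a < q τ}
        have hV : MeasurableSet V := measurableSet_lt measurable_const hq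
        have hV' : MeasurableSet (φ ⁻¹' V) := hφ.measurable hV
        have hle1 : μ (E ∩ φ ⁻¹' V) ≤ 1 := prob_le_one
        -- The threshold with the mass of the intersection lies below both `w` and the indicator of
        -- `V`, hence below their product on the right-hand side.
        obtain ⟨w', hw', hw'E⟩ := exists_isThreshold (μ := μ) hr hle1
        have l1 : w' ≤ᵐ[μ] w := by
          refine hw.ae_le hw' ?_ ?_
          · rw [hwE]; exact measure_ne_top _ _
          · rw [hwE, hw'E]; exact measure_mono inter_subset_left
        have l2 : w' ≤ᵐ[μ] V.indicator 1 := by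
          refine hw'.ae_le_indicator hV ?_ ?_
          · filter_upwards [hmono] with x hx h1 h2
            by_contra h3
            exact h1 (lt_of_lt_of_le h2 (hx (not_lt.1 h3)))
          · rw [hw'E, ← hφ.measure_preimage hV.nullMeasurableSet]
            exact measure_mono inter_subset_right
        have := h _ (hE.inter hV') w' hw' hw'E
        calc ∫⁻ τ in E, {x : T × ℝ | x.2 < q (φ x.1)}.indicator (fun x => f x.1) (τ, a) ∂μ
            = ∫⁻ τ in E, (φ ⁻¹' V).indicator f τ ∂μ := by
              refine lintegral_congr fun τ => ?_
              by_cases h : a < q (φ τ) <;> simp [h, V]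
          _ = ∫⁻ τ in E ∩ φ ⁻¹' V, f τ ∂μ := by
              rw [lintegral_indicator hV', Measure.restrict_restrict hV', inter_comm]
          _ ≤ ∫⁻ τ, w' τ * g τ ∂μ := this
          _ ≤ _ := by
              refine lintegral_mono_ae ?_
              filter_upwards [l1, l2] with τ h1 h2
              by_cases h : a < q τ
              · simp only [indicator, mem_ofPred_eq, h, if_true]
                gcongr
              · have : w' τ = 0 := by simpa [V, h] using h2
                simp [this]
    _ = ∫⁻ τ, ∫⁻ a in Ioi (0 : ℝ),
          {x : T × ℝ | x.2 < q x.1}.indicator (fun x => w x.1 * g x.1) (τ, a) ∂volume ∂μ := by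
        rw [lintegral_lintegral_swap]
        exact (((hw.measurable.comp measurable_fst).mul
          (hg.comp measurable_fst)).indicator hset).aemeasurable.prod_swap
    _ = ∫⁻ τ, w τ * (ENNReal.ofReal (q τ) * g τ) ∂μ := by
        refine lintegral_congr fun τ => ?_
        rw [ofReal_eq_lintegral_lt, ← lintegral_mul_const _
          (measurable_one.indicator measurableSet_Iio), ← lintegral_const_mul _
          ((measurable_one.indicator measurableSet_Iio).mul_const _)]
        exact lintegral_congr fun a => (e2 τ a).symm

lemma RearrLE.const_mul {f g : T → ℝ≥0∞} (h : RearrLE μ r f g) (hf : Measurable f)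
    (hg : Measurable g) (c : ℝ≥0∞) : RearrLE μ r (fun τ => c * f τ) (fun τ => c * g τ) := by
  intro E hE w hw hwE
  rw [lintegral_const_mul _ hf]
  calc c * ∫⁻ τ in E, f τ ∂μ ≤ c * ∫⁻ τ, w τ * g τ ∂μ := mul_le_mul_right (h E hE w hw hwE) c
    _ = _ := by
      rw [← lintegral_const_mul c (f := fun τ => w τ * g τ) (hw.measurable.mul hg)]
      exact lintegral_congr fun τ => by ring

lemma RearrLE.lintegral [SFinite μ] {ν : Measure ℝ} [SFinite ν] {f g : T → ℝ → ℝ≥0∞}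
    (hf : Measurable fun x : T × ℝ => f x.1 x.2) (hg : Measurable fun x : T × ℝ => g x.1 x.2)
    (h : ∀ᵐ u ∂ν, RearrLE μ r (fun τ => f τ u) (fun τ => g τ u)) :
    RearrLE μ r (fun τ => ∫⁻ u, f τ u ∂ν) (fun τ => ∫⁻ u, g τ u ∂ν) := by
  intro E hE w hw hwE
  rw [lintegral_lintegral_swap hf.aemeasurable]
  calc ∫⁻ u, ∫⁻ τ in E, f τ u ∂μ ∂ν ≤ ∫⁻ u, ∫⁻ τ, w τ * g τ u ∂μ ∂ν := by
        refine lintegral_mono_ae ?_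
        filter_upwards [h] with u hu
        exact hu E hE w hw hwE
    _ = ∫⁻ τ, ∫⁻ u, w τ * g τ u ∂ν ∂μ := by
        rw [lintegral_lintegral_swap]
        exact ((hw.measurable.comp measurable_fst).mul hg).aemeasurable.prod_swap
    _ = _ := by
        refine lintegral_congr fun τ => ?_
        rw [lintegral_const_mul]
        exact hg.comp measurable_prodMk_left

lemma RearrLE.tsum {f g : ℕ → T → ℝ≥0∞} (hf : ∀ n, Measurable (f n))
    (hg : ∀ n, Measurable (g n)) (h : ∀ n, RearrLE μ r (f n) (g n)) :
    RearrLE μ r (fun τ => ∑' n, f n τ) (fun τ => ∑' n, g n τ) := by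
  intro E hE w hw hwE
  rw [lintegral_tsum fun n => (hf n).aemeasurable]
  simp_rw [← ENNReal.tsum_mul_left]
  rw [lintegral_tsum (f := fun n τ => w τ * g n τ)
    fun n => (hw.measurable.mul (hg n)).aemeasurable]
  exact ENNReal.tsum_le_tsum fun n => h n E hE w hw hwE

/-- Subtraction is truncated, so these are integrals of `(f - a)⁺`. Test the majorization on `E = {a
< f}`: the left side is `∫_E f - a μ(E)`, and `∫ w g - a ∫ w ≤ ∫ (g - a)⁺` because `w ≤ 1`. -/
lemma RearrLE.lintegral_sub_le [IsProbabilityMeasure μ] {f g : T → ℝ≥0∞} (h : RearrLE μ r f g)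
    (hr : Measurable r) (hf : Measurable f) {a : ℝ≥0∞} (ha : a ≠ ∞) :
    ∫⁻ τ, (f τ - a) ∂μ ≤ ∫⁻ τ, (g τ - a) ∂μ := by
  set E : Set T := {τ | a < f τ}
  have hE : MeasurableSet E := measurableSet_lt measurable_const hf
  obtain ⟨w, hw, hwE⟩ := exists_isThreshold (μ := μ) hr (m := μ E) prob_le_one
  have hm : a * μ E ≠ ∞ := ENNReal.mul_ne_top ha (measure_ne_top _ _)
  have e1 : ∫⁻ τ, (f τ - a) ∂μ = ∫⁻ τ in E, (f τ - a) ∂μ := by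
    rw [← lintegral_indicator hE]
    refine lintegral_congr fun τ => ?_
    by_cases hτ : a < f τ
    · simp [E, hτ]
    · simp [E, hτ, tsub_eq_zero_of_le (not_lt.1 hτ)]
  have e2 : ∫⁻ τ in E, f τ ∂μ = ∫⁻ τ in E, (f τ - a) ∂μ + a * μ E := by
    rw [← setLIntegral_const, ← lintegral_add_right _ measurable_const]
    refine setLIntegral_congr_fun hE fun τ hτ => ?_
    exact (tsub_add_cancel_of_le (le_of_lt hτ)).symm
  have e3 : ∫⁻ τ, w τ * g τ ∂μ ≤ ∫⁻ τ, (g τ - a) ∂μ + a * μ E := by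
    rw [← hwE, ← lintegral_const_mul _ hw.measurable,
      ← lintegral_add_right _ (hw.measurable.const_mul a)]
    refine lintegral_mono fun τ => ?_
    calc w τ * g τ ≤ w τ * ((g τ - a) + a) := by gcongr; exact le_tsub_add
      _ = w τ * (g τ - a) + a * w τ := by ring
      _ ≤ 1 * (g τ - a) + a * w τ := by gcongr; exact hw.le_one τ
      _ = _ := by rw [one_mul]
  have := (h E hE w hw hwE).trans e3
  rw [e2] at this
  rw [e1]
  exact (ENNReal.add_le_add_iff_right hm).1 this

/-- Writes the convex power as a positive mixture of the functions `(x - a)⁺`, with density its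
second derivative. This reduces moments to `RearrLE.lintegral_sub_le`. -/
lemma rpow_eq_lintegral_sub {p : ℝ} (hp : 1 < p) (x : ℝ≥0∞) :
    x ^ p = ∫⁻ a in Ioi (0 : ℝ), ENNReal.ofReal (p * (p - 1) * a ^ (p - 2)) *
      (x - ENNReal.ofReal a) := by
  have hmeas : Measurable fun a : ℝ => ENNReal.ofReal (p * (p - 1) * a ^ (p - 2)) := by fun_prop
  have hpp : 0 < p * (p - 1) := mul_pos (by linarith) (by linarith)
  rcases eq_or_ne x ∞ with rfl | hx
  · rw [ENNReal.top_rpow_of_pos (by linarith)]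
    symm
    rw [eq_top_iff]
    calc ∞ = ∫⁻ a in Ioi (0 : ℝ), ∞ := by simp
      _ ≤ _ := by
        refine setLIntegral_mono' measurableSet_Ioi fun a ha => ?_
        rw [ENNReal.top_sub ENNReal.ofReal_ne_top, ENNReal.mul_top]
        rw [Ne, ENNReal.ofReal_eq_zero, not_le]
        exact mul_pos hpp (Real.rpow_pos_of_pos ha _)
  obtain ⟨y, hy, rfl⟩ : ∃ y : ℝ, 0 ≤ y ∧ ENNReal.ofReal y = x :=
    ⟨x.toReal, ENNReal.toReal_nonneg, ENNReal.ofReal_toReal hx⟩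
  rw [ENNReal.ofReal_rpow_of_nonneg hy (by linarith)]
  have i1 : IntervalIntegrable (fun a : ℝ => a ^ (p - 2)) volume 0 y :=
    intervalIntegral.intervalIntegrable_rpow' (by linarith)
  have i2 : IntervalIntegrable (fun a : ℝ => a ^ (p - 1)) volume 0 y :=
    intervalIntegral.intervalIntegrable_rpow' (by linarith)
  have hcong : EqOn (fun a : ℝ => p * (p - 1) * a ^ (p - 2) * (y - a))
      (fun a => p * (p - 1) * y * a ^ (p - 2) - p * (p - 1) * a ^ (p - 1)) (Ioc 0 y) := by
    intro a ha
    have : a ^ (p - 1) = a ^ (p - 2) * a := by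
      rw [← Real.rpow_add_one ha.1.ne']; congr 1; ring
    simp only [this]; ring
  have i3 : IntegrableOn (fun a : ℝ => p * (p - 1) * a ^ (p - 2) * (y - a)) (Ioc 0 y) := by
    refine IntegrableOn.congr_fun ?_ hcong.symm measurableSet_Ioc
    have := (i1.const_mul (p * (p - 1) * y)).sub (i2.const_mul (p * (p - 1)))
    exact (intervalIntegrable_iff_integrableOn_Ioc_of_le hy).1 this
  have hval : ∫ a in Ioc 0 y, p * (p - 1) * a ^ (p - 2) * (y - a) = y ^ p := by
    rw [setIntegral_congr_fun measurableSet_Ioc hcong, ← intervalIntegral.integral_of_le hy,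
      intervalIntegral.integral_sub (i1.const_mul _) (i2.const_mul _),
      intervalIntegral.integral_const_mul, intervalIntegral.integral_const_mul,
      integral_rpow (Or.inl (by linarith)), integral_rpow (Or.inl (by linarith))]
    rw [show p - 2 + 1 = p - 1 by ring, show p - 1 + 1 = p by ring,
      Real.zero_rpow (by linarith), Real.zero_rpow (by linarith)]
    have hyy : y ^ p = y * y ^ (p - 1) := by
      rcases eq_or_lt_of_le hy with rfl | hy0
      · rw [Real.zero_rpow (by linarith), zero_mul]
      · rw [mul_comm, ← Real.rpow_add_one hy0.ne']; congr 1; ring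
    have h1 : p - 1 ≠ 0 := by linarith
    have h2 : p ≠ 0 := by linarith
    rw [hyy]; field_simp; ring
  rw [← hval, ofReal_integral_eq_lintegral_ofReal i3, ← Ioc_union_Ioi_eq_Ioi hy,
    lintegral_union measurableSet_Ioi (Ioc_disjoint_Ioi le_rfl)]
  · rw [setLIntegral_congr_fun measurableSet_Ioi
      (g := fun _ => (0 : ℝ≥0∞)), lintegral_zero, add_zero]
    · refine setLIntegral_congr_fun measurableSet_Ioc fun a ha => ?_
      rw [← ENNReal.ofReal_sub _ ha.1.le, ENNReal.ofReal_mul]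
      exact mul_nonneg hpp.le (Real.rpow_nonneg ha.1.le _)
    · intro a ha
      beta_reduce
      rw [tsub_eq_zero_of_le (ENNReal.ofReal_le_ofReal (le_of_lt ha)), mul_zero]
  · refine (ae_restrict_iff' measurableSet_Ioc).2 (Filter.Eventually.of_forall fun a ha => ?_)
    exact mul_nonneg (mul_nonneg hpp.le (Real.rpow_nonneg ha.1.le _)) (by linarith [ha.2])

lemma RearrLE.lintegral_rpow_le [IsProbabilityMeasure μ] {f g : T → ℝ≥0∞}
    (h : RearrLE μ r f g) (hr : Measurable r) (hf : Measurable f) (hg : Measurable g)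
    {p : ℝ} (hp : 1 ≤ p) :
    ∫⁻ τ, f τ ^ p ∂μ ≤ ∫⁻ τ, g τ ^ p ∂μ := by
  -- For `p = 1` the mixture degenerates, and the truncated inequality at `a = 0` is the claim.
  rcases eq_or_lt_of_le hp with rfl | hp
  · simpa using h.lintegral_sub_le hr hf ENNReal.zero_ne_top
  have hmeas : ∀ f : T → ℝ≥0∞, Measurable f → Measurable fun x : T × ℝ =>
      ENNReal.ofReal (p * (p - 1) * x.2 ^ (p - 2)) * (f x.1 - ENNReal.ofReal x.2) := by
    intro f hf
    fun_prop
  simp_rw [rpow_eq_lintegral_sub hp]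
  rw [lintegral_lintegral_swap (hmeas f hf).aemeasurable,
    lintegral_lintegral_swap (f := fun τ a => ENNReal.ofReal (p * (p - 1) * a ^ (p - 2)) *
      (g τ - ENNReal.ofReal a)) (hmeas g hg).aemeasurable]
  refine lintegral_mono fun a => ?_
  rw [lintegral_const_mul _ (by fun_prop), lintegral_const_mul _ (by fun_prop)]
  exact mul_le_mul_right (h.lintegral_sub_le hr hf ENNReal.ofReal_ne_top) _

/-! ### Neumann series of the Volterra equation. -/

/-- The terms of the Neumann series of the Volterra equation `y t = 1 + ∫ K t u * q u * y u ∂ν`. -/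
def neumann (ν : Measure ℝ) (K : ℝ → ℝ → ℝ≥0∞) (q : ℝ → ℝ) : ℕ → ℝ → ℝ≥0∞
  | 0, _ => 1
  | n + 1, t => ∫⁻ u, K t u * (ENNReal.ofReal (q u) * neumann ν K q n u) ∂ν

lemma measurable_neumann {ν : Measure ℝ} [SFinite ν] {K : ℝ → ℝ → ℝ≥0∞}
    (hK : Measurable fun x : ℝ × ℝ => K x.1 x.2) {q : T → ℝ → ℝ}
    (hq : Measurable fun x : T × ℝ => q x.1 x.2) (n : ℕ) :
    Measurable fun x : T × ℝ => neumann ν K (q x.1) n x.2 := by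
  induction n with
  | zero => exact measurable_const
  | succ n ih =>
    simp only [neumann]
    refine Measurable.lintegral_prod_right' (f := fun z : (T × ℝ) × ℝ =>
      K z.1.2 z.2 * (ENNReal.ofReal (q z.1.1 z.2) * neumann ν K (q z.1.1) n z.2)) ?_
    have h1 : Measurable fun z : (T × ℝ) × ℝ => K z.1.2 z.2 :=
      hK.comp (f := fun z : (T × ℝ) × ℝ => (z.1.2, z.2)) (by fun_prop)
    have h2 : Measurable fun z : (T × ℝ) × ℝ => q z.1.1 z.2 :=
      hq.comp (f := fun z : (T × ℝ) × ℝ => (z.1.1, z.2)) (by fun_prop)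
    have h3 : Measurable fun z : (T × ℝ) × ℝ => neumann ν K (q z.1.1) n z.2 :=
      ih.comp (f := fun z : (T × ℝ) × ℝ => (z.1.1, z.2)) (by fun_prop)
    exact h1.mul (h2.ennreal_ofReal.mul h3)

/-- Induction along the recursion. It is essential that one rank `r` orders the coefficients at
almost all times: the majorant then stays arranged along `r` whatever time the next factor comes
from. -/
lemma rearrLE_neumann [IsProbabilityMeasure μ] {ν : Measure ℝ} [SFinite ν]
    {K : ℝ → ℝ → ℝ≥0∞} (hK : Measurable fun x : ℝ × ℝ => K x.1 x.2) (hr : Measurable r)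
    {q : T → ℝ → ℝ} (hq : Measurable fun x : T × ℝ => q x.1 x.2)
    (hmono : ∀ᵐ u ∂ν, ∀ᵐ x ∂μ.prod μ, r x.2 ≤ r x.1 → q x.2 u ≤ q x.1 u)
    {σ : ℝ → T → T} (hσ : Measurable fun x : T × ℝ => σ x.2 x.1)
    (hpres : ∀ᵐ u ∂ν, MeasurePreserving (σ u) μ μ) (n : ℕ) (t : ℝ) :
    RearrLE μ r (fun τ => neumann ν K (fun u => q (σ u τ) u) n t)
      (fun τ => neumann ν K (q τ) n t) := by
  have hqσ : Measurable fun x : T × ℝ => q (σ x.2 x.1) x.2 :=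
    hq.comp (f := fun x : T × ℝ => (σ x.2 x.1, x.2)) (hσ.prodMk measurable_snd)
  induction n generalizing t with
  | zero => exact RearrLE.one
  | succ n ih =>
    simp only [neumann]
    have hKt : Measurable fun x : T × ℝ => K t x.2 :=
      hK.comp (f := fun x : T × ℝ => (t, x.2)) (by fun_prop)
    have m1 := measurable_neumann (ν := ν) hK (q := fun τ u => q (σ u τ) u) hqσ n
    have m2 := measurable_neumann (ν := ν) hK hq n
    refine RearrLE.lintegral (hKt.mul (hqσ.ennreal_ofReal.mul m1))
      (hKt.mul (hq.ennreal_ofReal.mul m2)) ?_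
    filter_upwards [hmono, hpres] with u hu hpu
    have c : ∀ {F : T × ℝ → ℝ≥0∞}, Measurable F → Measurable fun τ => F (τ, u) :=
      fun hF => hF.comp measurable_prodMk_right
    exact ((ih u).mul_comp hr (c m1) (c m2) (hq.comp (measurable_prodMk_right (y := u)))
      hu hpu).const_mul
      (c (hqσ.ennreal_ofReal.mul m1)) (c (hq.ennreal_ofReal.mul m2)) _

lemma lintegral_neumann_rpow_le [IsProbabilityMeasure μ] {ν : Measure ℝ} [SFinite ν]
    {K : ℝ → ℝ → ℝ≥0∞} (hK : Measurable fun x : ℝ × ℝ => K x.1 x.2) (hr : Measurable r)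
    {q : T → ℝ → ℝ} (hq : Measurable fun x : T × ℝ => q x.1 x.2)
    (hmono : ∀ᵐ u ∂ν, ∀ᵐ x ∂μ.prod μ, r x.2 ≤ r x.1 → q x.2 u ≤ q x.1 u)
    {σ : ℝ → T → T} (hσ : Measurable fun x : T × ℝ => σ x.2 x.1)
    (hpres : ∀ᵐ u ∂ν, MeasurePreserving (σ u) μ μ) (t : ℝ) {p : ℝ} (hp : 1 ≤ p) :
    ∫⁻ τ, (∑' n, neumann ν K (fun u => q (σ u τ) u) n t) ^ p ∂μ ≤
      ∫⁻ τ, (∑' n, neumann ν K (q τ) n t) ^ p ∂μ := by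
  have hqσ : Measurable fun x : T × ℝ => q (σ x.2 x.1) x.2 :=
    hq.comp (f := fun x : T × ℝ => (σ x.2 x.1, x.2)) (hσ.prodMk measurable_snd)
  have c : ∀ {F : T × ℝ → ℝ≥0∞}, Measurable F → Measurable fun τ => F (τ, t) :=
    fun hF => hF.comp measurable_prodMk_right
  have m1 := fun n => c (measurable_neumann (ν := ν) hK (q := fun τ u => q (σ u τ) u) hqσ n)
  have m2 := fun n => c (measurable_neumann (ν := ν) hK hq n)
  exact (RearrLE.tsum m1 m2 fun n => rearrLE_neumann hK hr hq hmono hσ hpres n t).lintegral_rpow_le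
    hr (Measurable.tsum m1) (Measurable.tsum m2) hp

/-- A supersolution of the Volterra equation dominates the Neumann series. -/
lemma tsum_neumann_le {ν : Measure ℝ} {K : ℝ → ℝ → ℝ≥0∞} {q : ℝ → ℝ} {S : Set ℝ}
    (hS : ∀ᵐ u ∂ν, u ∈ S) {z : ℝ → ℝ≥0∞}
    (hm : ∀ n t, AEMeasurable (fun u => K t u * (ENNReal.ofReal (q u) * neumann ν K q n u)) ν)
    (hz : ∀ t ∈ S, 1 + ∫⁻ u, K t u * (ENNReal.ofReal (q u) * z u) ∂ν ≤ z t) {t : ℝ}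
    (ht : t ∈ S) : ∑' n, neumann ν K q n t ≤ z t := by
  refine ENNReal.tsum_le_of_sum_range_le fun n => ?_
  induction n generalizing t with
  | zero => simp
  | succ n ih =>
    rw [Finset.sum_range_succ', add_comm]
    refine le_trans ?_ (hz t ht)
    simp only [neumann]
    gcongr
    rw [← lintegral_finsetSum' _ fun i _ => hm i t]
    refine lintegral_mono_ae ?_
    filter_upwards [hS] with u hu
    rw [← Finset.mul_sum, ← Finset.mul_sum]
    gcongr
    exact ih hu

/-- A bounded subsolution of the Volterra equation is dominated by the Neumann series. -/
lemma le_tsum_neumann {ν : Measure ℝ} {K : ℝ → ℝ → ℝ≥0∞} {q : ℝ → ℝ} {S : Set ℝ}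
    (hS : ∀ᵐ u ∂ν, u ∈ S) {z : ℝ → ℝ≥0∞} {C : ℝ≥0∞} (hC : C ≠ ∞)
    (hm : ∀ n t, AEMeasurable (fun u => K t u * (ENNReal.ofReal (q u) * neumann ν K q n u)) ν)
    (hz : ∀ t ∈ S, z t ≤ 1 + ∫⁻ u, K t u * (ENNReal.ofReal (q u) * z u) ∂ν)
    (hb : ∀ t ∈ S, z t ≤ C) {t : ℝ} (ht : t ∈ S) : z t ≤ ∑' n, neumann ν K q n t := by
  -- Iterating the inequality `n` times leaves a remainder in which `z` is estimated by `C`. If the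
  -- series converges its terms tend to zero and the remainder disappears; otherwise there is
  -- nothing to prove.
  have key : ∀ n, ∀ t ∈ S, z t ≤ ∑ i ∈ Finset.range n, neumann ν K q i t + C * neumann ν K q n t := by
    intro n
    induction n with
    | zero => intro t ht; simpa [neumann] using hb t ht
    | succ n ih =>
      intro t ht
      refine (hz t ht).trans ?_
      rw [Finset.sum_range_succ', add_comm (∑ i ∈ _, _), add_assoc]
      simp only [neumann]
      gcongr
      rw [← lintegral_finsetSum' _ fun i _ => hm i t, ← lintegral_const_mul' _ _ hC,
        ← lintegral_add_right' _ ((hm n t).const_mul C)]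
      refine lintegral_mono_ae ?_
      filter_upwards [hS] with u hu
      calc K t u * (ENNReal.ofReal (q u) * z u)
          ≤ K t u * (ENNReal.ofReal (q u) *
            (∑ i ∈ Finset.range n, neumann ν K q i u + C * neumann ν K q n u)) := by
            gcongr; exact ih u hu
        _ = _ := by rw [← Finset.mul_sum, ← Finset.mul_sum]; ring
  by_cases htop : ∑' n, neumann ν K q n t = ∞
  · rw [htop]; exact le_top
  have h0 : Filter.Tendsto (fun n => neumann ν K q n t) Filter.atTop (nhds 0) :=
    ENNReal.tendsto_atTop_zero_of_tsum_ne_top htop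
  have h1 := ENNReal.Tendsto.const_mul h0 (Or.inr hC)
  rw [mul_zero] at h1
  have h2 : Filter.Tendsto (fun n => ∑' i, neumann ν K q i t + C * neumann ν K q n t)
      Filter.atTop (nhds (∑' i, neumann ν K q i t + 0)) := tendsto_const_nhds.add h1
  rw [add_zero] at h2
  refine ge_of_tendsto' h2 fun n => (key n t ht).trans ?_
  gcongr
  exact ENNReal.sum_le_tsum _

end Rearrangement

/-! ### Motions whose acceleration is a measure, and their Wronskians. -/

/-- The velocity `1 + ∫_{(0, t]} g dm` with acceleration `g · m`. -/
def vel (m : Measure ℝ) (g : ℝ → ℝ) (t : ℝ) : ℝ := 1 + ∫ u in Ioc 0 t, g u ∂m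

/-- The position with acceleration `g · m`, started at `0` with unit velocity. -/
def pos (m : Measure ℝ) (g : ℝ → ℝ) (t : ℝ) : ℝ := ∫ u in (0 : ℝ)..t, vel m g u

section Motion

variable {m : Measure ℝ} {g g₁ g₂ : ℝ → ℝ}

/-- Atoms of `m` make the velocity jump, so only right continuity is available. Accordingly
positions are differentiated from the right throughout. -/
lemma continuousWithinAt_setIntegral_Ioc (hg : Integrable g m) (a t : ℝ) :
    ContinuousWithinAt (fun x => ∫ u in Ioc a x, g u ∂m) (Ici t) t := by
  have : (fun x => ∫ u in Ioc a x, g u ∂m) = fun x => ∫ u, (Ioc a x).indicator g u ∂m := by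
    ext x
    rw [integral_indicator measurableSet_Ioc]
  rw [this]
  refine continuousWithinAt_of_dominated (bound := fun u => ‖g u‖)
    (Eventually.of_forall fun x => hg.aestronglyMeasurable.indicator measurableSet_Ioc)
    (Eventually.of_forall fun x => Eventually.of_forall fun u => norm_indicator_le_norm_self _ _)
    hg.norm (Eventually.of_forall fun u => ?_)
  refine continuousWithinAt_const.congr_of_eventuallyEq (f := fun _ => (Ioc a t).indicator g u) ?_ rfl
  rcases le_or_gt u t with hu | hu
  · filter_upwards [self_mem_nhdsWithin] with x hx
    have : u ∈ Ioc a x ↔ u ∈ Ioc a t :=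
      ⟨fun h => ⟨h.1, hu⟩, fun h => ⟨h.1, hu.trans hx⟩⟩
    by_cases h : u ∈ Ioc a t
    · rw [indicator_of_mem h, indicator_of_mem (this.2 h)]
    · rw [indicator_of_notMem h, indicator_of_notMem (mt this.1 h)]
  · filter_upwards [mem_nhdsWithin_of_mem_nhds (Iio_mem_nhds hu)] with x hx
    have h1 : u ∉ Ioc a x := fun h => absurd h.2 (not_le.2 hx)
    have h2 : u ∉ Ioc a t := fun h => absurd h.2 (not_le.2 hu)
    simp [h1, h2]

lemma measurable_setIntegral_Ioc [SFinite m] (hg : AEStronglyMeasurable g m) (a : ℝ) :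
    Measurable fun x => ∫ u in Ioc a x, g u ∂m := by
  have : (fun x => ∫ u in Ioc a x, g u ∂m) =
      fun x => ∫ u, {y : ℝ × ℝ | a < y.2 ∧ y.2 ≤ y.1}.indicator (fun y => hg.mk g y.2) (x, u) ∂m := by
    ext x
    rw [← integral_indicator measurableSet_Ioc]
    refine integral_congr_ae ?_
    filter_upwards [hg.ae_eq_mk] with u hu
    by_cases h : a < u ∧ u ≤ x
    · simp [indicator, h, hu]
    · simp [indicator, h]
  rw [this]
  refine (StronglyMeasurable.integral_prod_right' ?_).measurable
  refine (hg.stronglyMeasurable_mk.comp_measurable measurable_snd).indicator ?_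
  exact (measurableSet_lt measurable_const measurable_snd).inter
    (measurableSet_le measurable_snd measurable_fst)

lemma abs_setIntegral_le (hg : Integrable g m) (S : Set ℝ) :
    |∫ u in S, g u ∂m| ≤ ∫ u, |g u| ∂m := by
  refine (abs_integral_le_integral_abs).trans ?_
  exact setIntegral_le_integral hg.abs (Eventually.of_forall fun _ => abs_nonneg _)

lemma vel_zero : vel m g 0 = 1 := by simp [vel]

lemma pos_zero : pos m g 0 = 0 := by simp [pos]

lemma measurable_vel [SFinite m] (hg : Integrable g m) : Measurable (vel m g) :=
  measurable_const.add (measurable_setIntegral_Ioc hg.aestronglyMeasurable 0)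

lemma continuousWithinAt_vel (hg : Integrable g m) (t : ℝ) :
    ContinuousWithinAt (vel m g) (Ici t) t :=
  continuousWithinAt_const.add (continuousWithinAt_setIntegral_Ioc hg 0 t)

lemma abs_vel_le (hg : Integrable g m) (t : ℝ) : |vel m g t| ≤ 1 + ∫ u, |g u| ∂m := by
  refine (abs_add_le _ _).trans ?_
  rw [abs_one]
  gcongr
  exact abs_setIntegral_le hg _

lemma intervalIntegrable_vel [SFinite m] (hg : Integrable g m) (a b : ℝ) :
    IntervalIntegrable (vel m g) volume a b := by
  refine (intervalIntegrable_const (c := 1 + ∫ u, |g u| ∂m)).mono_fun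
    (measurable_vel hg).aestronglyMeasurable (Eventually.of_forall fun t => ?_)
  exact (abs_vel_le hg t).trans (le_abs_self _)

lemma continuous_pos [SFinite m] (hg : Integrable g m) : Continuous (pos m g) :=
  intervalIntegral.continuous_primitive (intervalIntegrable_vel hg) 0

lemma hasDerivWithinAt_pos [SFinite m] (hg : Integrable g m) (t : ℝ) :
    HasDerivWithinAt (pos m g) (vel m g t) (Ioi t) t := by
  have : HasDerivWithinAt (pos m g) (vel m g t) (Ici t) t :=
    intervalIntegral.integral_hasDerivWithinAt_right (intervalIntegrable_vel hg 0 t)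
      ((measurable_vel hg).stronglyMeasurable.stronglyMeasurableAtFilter)
      ((continuousWithinAt_vel hg t).mono Ioi_subset_Ici_self)
  exact this.mono Ioi_subset_Ici_self

lemma pos_sub_pos [SFinite m] (hg : Integrable g m) {a b : ℝ} (hab : a ≤ b) :
    pos m g b - pos m g a = ∫ u in Ioc a b, vel m g u := by
  rw [pos, pos, intervalIntegral.integral_interval_sub_left (intervalIntegrable_vel hg _ _)
    (intervalIntegrable_vel hg _ _), intervalIntegral.integral_of_le hab]

lemma abs_pos_le (hg : Integrable g m) {t : ℝ} (ht : 0 ≤ t) :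
    |pos m g t| ≤ (1 + ∫ u, |g u| ∂m) * t := by
  have := intervalIntegral.norm_integral_le_of_norm_le_const (a := 0) (b := t)
    (f := vel m g) (C := 1 + ∫ u, |g u| ∂m) fun x _ => abs_vel_le hg x
  rwa [sub_zero, abs_of_nonneg ht, Real.norm_eq_abs] at this

lemma tendsto_pos_div_id [SFinite m] (hg : Integrable g m) :
    Tendsto (fun t => pos m g t / t) (𝓝[>] 0) (𝓝 1) := by
  have h := (hasDerivWithinAt_iff_tendsto_slope' (by simp)).1 (hasDerivWithinAt_pos hg 0)
  rw [vel_zero] at h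
  refine h.congr fun t => ?_
  rw [slope_def_field, pos_zero, sub_zero, sub_zero]

lemma tendsto_pos_div_pos [SFinite m] (hg₁ : Integrable g₁ m) (hg₂ : Integrable g₂ m) :
    Tendsto (fun t => pos m g₁ t / pos m g₂ t) (𝓝[>] 0) (𝓝 1) := by
  have h := (tendsto_pos_div_id hg₁).div (tendsto_pos_div_id hg₂) one_ne_zero
  rw [div_one] at h
  refine h.congr' ?_
  filter_upwards [self_mem_nhdsWithin] with t ht
  exact div_div_div_cancel_right₀ (ne_of_gt ht) _ _

/-- A motion that stays positive on `(0, s]` is bounded below by a linear function. -/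
lemma exists_mul_le_pos [SFinite m] (hg : Integrable g m) {s : ℝ} (hs : 0 < s)
    (h : ∀ t ∈ Ioc 0 s, 0 < pos m g t) : ∃ c > 0, ∀ t ∈ Ioc 0 s, c * t ≤ pos m g t := by
  -- Near `0` the unit initial velocity gives slope at least `1/2`; on the remaining compact
  -- interval the minimum is positive.
  have h1 := (tendsto_pos_div_id hg).eventually (lt_mem_nhds (show (1 / 2 : ℝ) < 1 by norm_num))
  obtain ⟨δ, hδ, hδ'⟩ := mem_nhdsGT_iff_exists_Ioo_subset.1 h1
  have hδ0 : 0 < δ := hδ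
  set d := min (δ / 2) s with hd
  have hd0 : 0 < d := lt_min (by linarith) hs
  have hds : d ≤ s := min_le_right _ _
  obtain ⟨x, hx, hmin⟩ := (isCompact_Icc (a := d) (b := s)).exists_isMinOn
    (nonempty_Icc.2 hds) (continuous_pos hg).continuousOn
  have hxpos : 0 < pos m g x := h x ⟨hd0.trans_le hx.1, hx.2⟩
  refine ⟨min (1 / 2) (pos m g x / s), lt_min (by norm_num) (div_pos hxpos hs), fun t ht => ?_⟩
  rcases lt_or_ge t d with htd | htd
  · have : t ∈ Ioo 0 δ := ⟨ht.1, htd.trans_le ((min_le_left _ _).trans (by linarith))⟩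
    have h2 : 1 / 2 < pos m g t / t := hδ' this
    rw [lt_div_iff₀ ht.1] at h2
    refine (mul_le_mul_of_nonneg_right (min_le_left _ _) ht.1.le).trans h2.le
  · have h2 : pos m g x ≤ pos m g t := hmin ⟨htd, ht.2⟩
    refine (mul_le_mul_of_nonneg_right (min_le_right _ _) ht.1.le).trans (le_trans ?_ h2)
    rw [div_mul_eq_mul_div, div_le_iff₀ hs]
    exact mul_le_mul_of_nonneg_left ht.2 hxpos.le

/-- Fubini on the closed triangle `u ≤ r`. Atoms of `m` cause no trouble: in the `r`-integral the
endpoint `r = u` is Lebesgue null, and in the `m`-integral the point `u = r` is included. -/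
lemma setIntegral_triangle_swap [SFinite m] {φ : ℝ → ℝ} {t : ℝ}
    (h : Integrable ({x : ℝ × ℝ | x.1 ≤ x.2}.indicator fun x => g x.1 * φ x.2)
      ((m.restrict (Ioc 0 t)).prod (volume.restrict (Ioc 0 t)))) :
    ∫ u in Ioc 0 t, g u * ∫ r in Ioc u t, φ r ∂volume ∂m =
      ∫ r in Ioc 0 t, φ r * ∫ u in Ioc 0 r, g u ∂m := by
  have hsw := integral_integral_swap (f := fun u r =>
    {x : ℝ × ℝ | x.1 ≤ x.2}.indicator (fun x => g x.1 * φ x.2) (u, r)) h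
  calc ∫ u in Ioc 0 t, g u * ∫ r in Ioc u t, φ r ∂volume ∂m
      = ∫ u in Ioc 0 t, ∫ r in Ioc 0 t,
          {x : ℝ × ℝ | x.1 ≤ x.2}.indicator (fun x => g x.1 * φ x.2) (u, r) ∂volume ∂m := by
        refine setIntegral_congr_fun measurableSet_Ioc fun u hu => ?_
        rw [← integral_const_mul, ← integral_Icc_eq_integral_Ioc]
        have e : Icc u t = Ici u ∩ Ioc 0 t := by
          ext r
          simp only [mem_Icc, mem_inter_iff, mem_Ici, mem_Ioc]
          exact ⟨fun h => ⟨h.1, hu.1.trans_le h.1, h.2⟩, fun h => ⟨h.1, h.2.2⟩⟩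
        rw [e, ← Measure.restrict_restrict measurableSet_Ici, ← integral_indicator measurableSet_Ici]
        rfl
    _ = ∫ r in Ioc 0 t, ∫ u in Ioc 0 t,
          {x : ℝ × ℝ | x.1 ≤ x.2}.indicator (fun x => g x.1 * φ x.2) (u, r) ∂m := hsw
    _ = _ := by
        refine setIntegral_congr_fun measurableSet_Ioc fun r hr => ?_
        rw [← integral_const_mul]
        have e : Ioc 0 r = Iic r ∩ Ioc 0 t := by
          ext u
          simp only [mem_inter_iff, mem_Iic, mem_Ioc]
          exact ⟨fun h => ⟨h.2, h.1, h.2.trans hr.2⟩, fun h => ⟨h.2.1, h.1⟩⟩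
        rw [e, ← Measure.restrict_restrict measurableSet_Iic, ← integral_indicator measurableSet_Iic]
        refine integral_congr_ae (Eventually.of_forall fun u => ?_)
        by_cases h : u ≤ r <;> simp [indicator, h, mul_comm]

lemma measurableSet_triangle : MeasurableSet {x : ℝ × ℝ | x.1 ≤ x.2} :=
  measurableSet_le measurable_fst measurable_snd

/-- Integration by parts for the product of a velocity and an absolutely continuous function. -/
lemma vel_mul_eq [SFinite m] (hg : Integrable g m) {t : ℝ} (ht : 0 ≤ t) {φ Z : ℝ → ℝ}
    (hφ : IntegrableOn φ (Ioc 0 t)) (hZ : ∀ u ∈ Icc 0 t, Z u = Z 0 + ∫ r in Ioc 0 u, φ r)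
    (hgZ : IntegrableOn (fun u => g u * Z u) (Ioc 0 t) m) :
    vel m g t * Z t = Z 0 + ∫ u in Ioc 0 t, g u * Z u ∂m + ∫ r in Ioc 0 t, vel m g r * φ r := by
  have hintg : Integrable ({x : ℝ × ℝ | x.1 ≤ x.2}.indicator fun x => g x.1 * φ x.2)
      ((m.restrict (Ioc 0 t)).prod (volume.restrict (Ioc 0 t))) :=
    (hg.restrict.mul_prod hφ).indicator measurableSet_triangle
  have hsw := setIntegral_triangle_swap hintg
  have hφv : IntegrableOn (fun r => φ r * ∫ u in Ioc 0 r, g u ∂m) (Ioc 0 t) := by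
    have hm : AEStronglyMeasurable (fun r => ∫ u in Ioc 0 r, g u ∂m)
        (volume.restrict (Ioc 0 t)) :=
      (measurable_setIntegral_Ioc hg.aestronglyMeasurable 0).aestronglyMeasurable
    exact Integrable.mul_bdd hφ hm
      (Eventually.of_forall fun r => (Real.norm_eq_abs _).le.trans (abs_setIntegral_le hg _))
  have e1 : ∫ u in Ioc 0 t, g u * ∫ r in Ioc u t, φ r ∂volume ∂m
      = ∫ u in Ioc 0 t, (g u * Z t - g u * Z u) ∂m := by
    refine setIntegral_congr_fun measurableSet_Ioc fun u hu => ?_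
    rw [hZ t ⟨ht, le_rfl⟩, hZ u ⟨hu.1.le, hu.2⟩, ← Ioc_union_Ioc_eq_Ioc hu.1.le hu.2,
      setIntegral_union (Ioc_disjoint_Ioc_of_le le_rfl) measurableSet_Ioc
        (hφ.mono_set (Ioc_subset_Ioc_right hu.2)) (hφ.mono_set (Ioc_subset_Ioc_left hu.1.le))]
    ring
  rw [integral_sub (hg.restrict.mul_const _) hgZ, integral_mul_const] at e1
  have e2 : ∫ r in Ioc 0 t, vel m g r * φ r
      = (∫ r in Ioc 0 t, φ r) + ∫ r in Ioc 0 t, φ r * ∫ u in Ioc 0 r, g u ∂m := by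
    rw [← integral_add hφ hφv]
    refine integral_congr_ae (Eventually.of_forall fun r => ?_)
    simp only [vel]; ring
  rw [e2, ← hsw, e1]
  have := hZ t ⟨ht, le_rfl⟩
  simp only [vel]
  linear_combination this

lemma integrableOn_mul_continuous (hg : Integrable g m) {Z : ℝ → ℝ} {a b : ℝ}
    (hZ : ContinuousOn Z (Icc a b)) : IntegrableOn (fun u => g u * Z u) (Ioc a b) m := by
  obtain ⟨C, hC⟩ := isCompact_Icc.exists_bound_of_continuousOn hZ
  refine Integrable.mul_bdd (c := C) hg.restrict ?_ ?_
  · exact (hZ.mono Ioc_subset_Icc_self).aestronglyMeasurable measurableSet_Ioc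
  · exact (ae_restrict_iff' measurableSet_Ioc).2
      (Eventually.of_forall fun u hu => hC u (Ioc_subset_Icc_self hu))

lemma vel_mul_pos [SFinite m] (hg₁ : Integrable g₁ m) (hg₂ : Integrable g₂ m) {t : ℝ}
    (ht : 0 ≤ t) : vel m g₁ t * pos m g₂ t =
      ∫ u in Ioc 0 t, g₁ u * pos m g₂ u ∂m + ∫ r in Ioc 0 t, vel m g₁ r * vel m g₂ r := by
  have := vel_mul_eq hg₁ ht (φ := vel m g₂) (Z := pos m g₂)
    ((intervalIntegrable_iff_integrableOn_Ioc_of_le ht).1 (intervalIntegrable_vel hg₂ 0 t))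
    (fun u hu => by rw [← pos_sub_pos hg₂ hu.1]; ring)
    (integrableOn_mul_continuous hg₁ (continuous_pos hg₂).continuousOn)
  rw [this, pos_zero, zero_add]

/-- The Wronskian of two motions. -/
def wronskian (m : Measure ℝ) (g₁ g₂ : ℝ → ℝ) (t : ℝ) : ℝ :=
  vel m g₁ t * pos m g₂ t - pos m g₁ t * vel m g₂ t

/-- Integrating each product by parts produces the same integral of the product of velocities, which
cancels. -/
lemma wronskian_eq [SFinite m] (hg₁ : Integrable g₁ m) (hg₂ : Integrable g₂ m) {t : ℝ}
    (ht : 0 ≤ t) : wronskian m g₁ g₂ t =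
      ∫ u in Ioc 0 t, (g₁ u * pos m g₂ u - g₂ u * pos m g₁ u) ∂m := by
  rw [integral_sub (integrableOn_mul_continuous hg₁ (continuous_pos hg₂).continuousOn)
    (integrableOn_mul_continuous hg₂ (continuous_pos hg₁).continuousOn), wronskian,
    mul_comm (pos m g₁ t), vel_mul_pos hg₁ hg₂ ht, vel_mul_pos hg₂ hg₁ ht]
  simp only [mul_comm (vel m g₂ _)]
  ring

lemma intervalIntegrable_wronskian_div [SFinite m] (hg₁ : Integrable g₁ m)
    (hg₂ : Integrable g₂ m) {a b : ℝ} (hab : a ≤ b) (h : ∀ t ∈ Icc a b, 0 < pos m g₂ t) :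
    IntervalIntegrable (fun r => wronskian m g₁ g₂ r / pos m g₂ r ^ 2) volume a b := by
  have h1 : IntervalIntegrable (wronskian m g₁ g₂) volume a b :=
    ((intervalIntegrable_vel hg₁ a b).mul_continuousOn (continuous_pos hg₂).continuousOn).sub
      ((intervalIntegrable_vel hg₂ a b).continuousOn_mul (continuous_pos hg₁).continuousOn)
  simp only [div_eq_mul_inv]
  refine h1.mul_continuousOn ?_
  rw [uIcc_of_le hab]
  exact ContinuousOn.inv₀ ((continuous_pos hg₂).pow 2).continuousOn
    fun t ht => (pow_pos (h t ht) 2).ne'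

/-- The quotient rule for right derivatives, integrated by the fundamental theorem for continuous
functions with an integrable right derivative. -/
lemma pos_div_pos_sub [SFinite m] (hg₁ : Integrable g₁ m) (hg₂ : Integrable g₂ m) {a b : ℝ}
    (hab : a ≤ b) (h : ∀ t ∈ Icc a b, 0 < pos m g₂ t) :
    ∫ r in Ioc a b, wronskian m g₁ g₂ r / pos m g₂ r ^ 2 =
      pos m g₁ b / pos m g₂ b - pos m g₁ a / pos m g₂ a := by
  rw [← intervalIntegral.integral_of_le hab]
  refine intervalIntegral.integral_eq_sub_of_hasDeriv_right
    (f := fun t => pos m g₁ t / pos m g₂ t) ?_ ?_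
    (intervalIntegrable_wronskian_div hg₁ hg₂ hab h)
  · rw [uIcc_of_le hab]
    exact (continuous_pos hg₁).continuousOn.div (continuous_pos hg₂).continuousOn
      fun t ht => (h t ht).ne'
  · intro x hx
    rw [min_eq_left hab, max_eq_right hab] at hx
    exact (hasDerivWithinAt_pos hg₁ x).div (hasDerivWithinAt_pos hg₂ x)
      (h x (Ioo_subset_Icc_self hx)).ne'

end Motion

/-! ### Quotients of solutions and Sturm comparison. -/

/-- The motion with acceleration `g · m` solves the Jacobi equation with coefficient `k · m` on
`(0, b]`. -/
structure IsSol (m : Measure ℝ) (k : ℝ → ℝ) (b : ℝ) (g : ℝ → ℝ) : Prop where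
  integrable : Integrable g m
  eq : ∀ u ∈ Ioc 0 b, g u = k u * pos m g u

/-- A solution of the Jacobi equation that is positive on `(0, s]`. -/
structure IsLive (m : Measure ℝ) (k : ℝ → ℝ) (s : ℝ) (g : ℝ → ℝ) : Prop extends
    IsSol m k s g where
  pos_pos : ∀ u ∈ Ioc 0 s, 0 < pos m g u

/-- The kernel of the Volterra equation satisfied by quotients by the solution `h`. -/
def kernel (h : ℝ → ℝ) (t u : ℝ) : ℝ≥0∞ := ∫⁻ r in Icc u t, ENNReal.ofReal (h u ^ 2 / h r ^ 2)

lemma kernel_of_lt {h : ℝ → ℝ} {t u : ℝ} (htu : t < u) : kernel h t u = 0 := by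
  simp [kernel, Icc_eq_empty (not_le.2 htu)]

lemma measurable_kernel {h : ℝ → ℝ} (hh : Continuous h) :
    Measurable fun x : ℝ × ℝ => kernel h x.1 x.2 := by
  have : (fun x : ℝ × ℝ => kernel h x.1 x.2) = fun x => ∫⁻ r,
      {y : (ℝ × ℝ) × ℝ | y.1.2 ≤ y.2 ∧ y.2 ≤ y.1.1}.indicator
        (fun y => ENNReal.ofReal (h y.1.2 ^ 2 / h y.2 ^ 2)) (x, r) := by
    ext x
    rw [kernel, ← lintegral_indicator measurableSet_Icc]
    rfl
  rw [this]
  refine Measurable.lintegral_prod_right' (Measurable.indicator ?_ ?_)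
  · have := hh.measurable
    fun_prop
  · exact (measurableSet_le (measurable_snd.comp measurable_fst) measurable_snd).inter
      (measurableSet_le measurable_snd (measurable_fst.comp measurable_fst))

/-- Tonelli translates between the Volterra kernel and the iterated integral given by the quotient
rule: the inner integral has the form of a Wronskian, the outer one divides it by `h²`. -/
lemma lintegral_kernel_mul {m : Measure ℝ} [SFinite m] (hm : ∀ᵐ u ∂m, 0 < u) {h : ℝ → ℝ}
    (hh : Continuous h) {F : ℝ → ℝ≥0∞} (hF : Measurable F) (t : ℝ) :
    ∫⁻ u, kernel h t u * F u ∂m = ∫⁻ r in Ioc 0 t, ENNReal.ofReal (1 / h r ^ 2) *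
      ∫⁻ u in Ioc 0 r, ENNReal.ofReal (h u ^ 2) * F u ∂m := by
  have hmeas := hh.measurable
  have hset : MeasurableSet {x : ℝ × ℝ | 0 < x.1 ∧ x.1 ≤ x.2} :=
    (measurableSet_lt measurable_const measurable_fst).inter
      (measurableSet_le measurable_fst measurable_snd)
  have hsw := lintegral_lintegral_swap (μ := m) (ν := volume.restrict (Ioc 0 t)) (f := fun u r =>
    {x : ℝ × ℝ | 0 < x.1 ∧ x.1 ≤ x.2}.indicator (fun x => ENNReal.ofReal (1 / h x.2 ^ 2) *
      (ENNReal.ofReal (h x.1 ^ 2) * F x.1)) (u, r))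
    (Measurable.indicator (by fun_prop) hset).aemeasurable
  calc ∫⁻ u, kernel h t u * F u ∂m
      = ∫⁻ u, ∫⁻ r in Ioc 0 t, {x : ℝ × ℝ | 0 < x.1 ∧ x.1 ≤ x.2}.indicator
          (fun x => ENNReal.ofReal (1 / h x.2 ^ 2) *
          (ENNReal.ofReal (h x.1 ^ 2) * F x.1)) (u, r) ∂volume ∂m := by
        refine lintegral_congr_ae ?_
        filter_upwards [hm] with u hu
        have e : Icc u t = Ici u ∩ Ioc 0 t := by
          ext r
          simp only [mem_Icc, mem_inter_iff, mem_Ici, mem_Ioc]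
          exact ⟨fun h => ⟨h.1, hu.trans_le h.1, h.2⟩, fun h => ⟨h.1, h.2.2⟩⟩
        rw [kernel, e, ← Measure.restrict_restrict measurableSet_Ici,
          ← lintegral_mul_const _ (by fun_prop), ← lintegral_indicator measurableSet_Ici]
        refine lintegral_congr fun r => ?_
        by_cases hr : u ≤ r
        · simp only [indicator, mem_Ici, hr, hu, mem_ofPred_eq, and_self, if_true]
          rw [← mul_assoc, ← ENNReal.ofReal_mul (by positivity)]
          congr 2
          ring
        · simp [indicator, hr]
    _ = _ := hsw
    _ = _ := by
        refine lintegral_congr fun r => ?_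
        rw [← lintegral_const_mul _ (by fun_prop), ← lintegral_indicator measurableSet_Ioc]
        rfl

lemma ofReal_integral_le_lintegral {α : Type*} [MeasurableSpace α] {μ : Measure α} (f : α → ℝ) :
    ENNReal.ofReal (∫ x, f x ∂μ) ≤ ∫⁻ x, ENNReal.ofReal (f x) ∂μ := by
  by_cases hf : Integrable f μ
  · calc ENNReal.ofReal (∫ x, f x ∂μ) ≤ ENNReal.ofReal (∫ x, max (f x) 0 ∂μ) :=
        ENNReal.ofReal_le_ofReal (integral_mono hf hf.pos_part fun x => le_max_left _ _)
      _ = ∫⁻ x, ENNReal.ofReal (max (f x) 0) ∂μ :=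
        ofReal_integral_eq_lintegral_ofReal hf.pos_part
          (Eventually.of_forall fun x => le_max_right _ _)
      _ = _ := by simp
  · simp [integral_undef hf]

section Comparison

variable {m : Measure ℝ} {k γ : ℝ → ℝ} {b s : ℝ} {g h : ℝ → ℝ}

lemma IsSol.wronskian_eq [SFinite m] (hg : IsSol m k b g) (hh : IsLive m γ s h) (hbs : b ≤ s) {t : ℝ}
    (ht : t ∈ Ioc 0 b) : wronskian m g h t =
      ∫ u in Ioc 0 t, (k u - γ u) * (pos m g u * pos m h u) ∂m := by
  rw [JacobiShuffle.wronskian_eq hg.integrable hh.integrable ht.1.le]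
  refine setIntegral_congr_fun measurableSet_Ioc fun u hu => ?_
  have hu' : u ∈ Ioc 0 b := ⟨hu.1, hu.2.trans ht.2⟩
  rw [hg.eq u hu', hh.eq u ⟨hu'.1, hu'.2.trans hbs⟩]
  ring

/-- Rewrites the positive part of the Wronskian density in terms of the ratio, in the form used by
`lintegral_kernel_mul`. -/
lemma ofReal_coeff_mul (hh : IsLive m γ s h) {u : ℝ} (hu : u ∈ Ioc 0 s) (hg : 0 ≤ pos m g u) :
    ENNReal.ofReal ((k u - γ u) * (pos m g u * pos m h u)) =
      ENNReal.ofReal (pos m h u ^ 2) *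
        (ENNReal.ofReal (k u - γ u) * ENNReal.ofReal (pos m g u / pos m h u)) := by
  have hp := hh.pos_pos u hu
  have e : (k u - γ u) * (pos m g u * pos m h u) =
      pos m h u ^ 2 * (pos m g u / pos m h u) * (k u - γ u) := by
    field_simp
  rw [e, ENNReal.ofReal_mul (by positivity), ENNReal.ofReal_mul (by positivity)]
  ring

variable [SFinite m]

/-- The quotient of a nonnegative solution by a positive one is a subsolution of the Volterra
equation for the positive part of the difference of the coefficients. -/
lemma IsSol.ratio_le (hm : ∀ᵐ u ∂m, 0 < u) (hk : Measurable k) (hγ : Measurable γ)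
    (hg : IsSol m k b g) (hh : IsLive m γ s h) (hbs : b ≤ s)
    (hnn : ∀ u ∈ Ioc 0 b, 0 ≤ pos m g u) {t : ℝ} (ht : t ∈ Ioc 0 b) :
    ENNReal.ofReal (pos m g t / pos m h t) ≤ 1 + ∫⁻ u, kernel (pos m h) t u *
      (ENNReal.ofReal (k u - γ u) * ENNReal.ofReal (pos m g u / pos m h u)) ∂m := by
  have cg := (continuous_pos hg.integrable).measurable
  have ch := (continuous_pos hh.integrable)
  have ch' := ch.measurable
  rw [lintegral_kernel_mul hm ch (by fun_prop)]
  set R := ∫⁻ r in Ioc 0 t, ENNReal.ofReal (1 / pos m h r ^ 2) *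
      ∫⁻ u in Ioc 0 r, ENNReal.ofReal (pos m h u ^ 2) *
        (ENNReal.ofReal (k u - γ u) * ENNReal.ofReal (pos m g u / pos m h u)) ∂m with hR
  -- Since `h⁻²` is singular at `0`, integration starts at `ε`. The ratio tends to `1` as `ε → 0`,
  -- which supplies the constant term of the equation.
  have key : ∀ ε ∈ Ioo 0 t, ENNReal.ofReal (pos m g t / pos m h t) ≤
      ENNReal.ofReal (pos m g ε / pos m h ε) + R := by
    intro ε hε
    have h1 := pos_div_pos_sub hg.integrable hh.integrable hε.2.le
      (fun x hx => hh.pos_pos x ⟨hε.1.trans_le hx.1, hx.2.trans (ht.2.trans hbs)⟩)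
    have h2 : pos m g t / pos m h t = pos m g ε / pos m h ε +
      ∫ r in Ioc ε t, wronskian m g h r / pos m h r ^ 2 := by rw [h1]; ring
    rw [h2]
    refine ENNReal.ofReal_add_le.trans ?_
    gcongr
    refine (ofReal_integral_le_lintegral _).trans ?_
    rw [hR]
    refine (setLIntegral_mono' measurableSet_Ioc fun r hr => ?_).trans
      (lintegral_mono_set (Ioc_subset_Ioc_left hε.1.le))
    have hr' : r ∈ Ioc 0 b := ⟨hε.1.trans hr.1, hr.2.trans ht.2⟩
    rw [div_eq_mul_one_div, mul_comm, ENNReal.ofReal_mul (by positivity)]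
    gcongr
    rw [hg.wronskian_eq hh hbs hr']
    refine (ofReal_integral_le_lintegral _).trans_eq ?_
    refine setLIntegral_congr_fun measurableSet_Ioc fun u hu => ?_
    have hu' : u ∈ Ioc 0 b := ⟨hu.1, hu.2.trans hr'.2⟩
    exact ofReal_coeff_mul hh ⟨hu'.1, hu'.2.trans hbs⟩ (hnn u hu')
  have hlim : Tendsto (fun ε => ENNReal.ofReal (pos m g ε / pos m h ε) + R) (𝓝[>] 0)
      (𝓝 (1 + R)) := by
    refine Tendsto.add_const _ ?_
    have := ENNReal.tendsto_ofReal (tendsto_pos_div_pos hg.integrable hh.integrable)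
    rwa [ENNReal.ofReal_one] at this
  refine ge_of_tendsto hlim ?_
  filter_upwards [Ioo_mem_nhdsGT ht.1] with ε hε using key ε hε

/-- The quotient of a nonnegative solution by a positive one with smaller coefficient solves the
Volterra equation. -/
lemma IsSol.le_ratio (hm : ∀ᵐ u ∂m, 0 < u) (hk : Measurable k) (hγ : Measurable γ)
    (hg : IsSol m k b g) (hh : IsLive m γ s h) (hbs : b ≤ s)
    (hnn : ∀ u ∈ Ioc 0 b, 0 ≤ pos m g u) (hle : ∀ᵐ u ∂m, u ∈ Ioc 0 b → γ u ≤ k u)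
    {t : ℝ} (ht : t ∈ Ioc 0 b) :
    1 + ∫⁻ u, kernel (pos m h) t u * (ENNReal.ofReal (k u - γ u) *
      ENNReal.ofReal (pos m g u / pos m h u)) ∂m ≤ ENNReal.ofReal (pos m g t / pos m h t) := by
  have cg := (continuous_pos hg.integrable).measurable
  have ch := (continuous_pos hh.integrable)
  have ch' := ch.measurable
  rw [lintegral_kernel_mul hm ch (by fun_prop)]
  set F : ℝ → ℝ≥0∞ := fun r => ENNReal.ofReal (1 / pos m h r ^ 2) *
      ∫⁻ u in Ioc 0 r, ENNReal.ofReal (pos m h u ^ 2) *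
        (ENNReal.ofReal (k u - γ u) * ENNReal.ofReal (pos m g u / pos m h u)) ∂m with hF
  have hnnr : ∀ r ∈ Ioc 0 b, ∀ᵐ u ∂m.restrict (Ioc 0 r),
      0 ≤ (k u - γ u) * (pos m g u * pos m h u) := by
    intro r hr
    filter_upwards [ae_restrict_of_ae hle, ae_restrict_mem measurableSet_Ioc] with u h1 h2
    have hu' : u ∈ Ioc 0 b := ⟨h2.1, h2.2.trans hr.2⟩
    exact mul_nonneg (sub_nonneg.2 (h1 hu')) (mul_nonneg (hnn u hu')
      (hh.pos_pos u ⟨hu'.1, hu'.2.trans hbs⟩).le)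
  -- With ordered coefficients no sign is lost, so every inequality of `IsSol.ratio_le` becomes an
  -- equality.
  have hW : ∀ r ∈ Ioc 0 b, 0 ≤ wronskian m g h r := by
    intro r hr
    rw [hg.wronskian_eq hh hbs hr]
    exact integral_nonneg_of_ae (hnnr r hr)
  have key : ∀ ε ∈ Ioo 0 t, ENNReal.ofReal (pos m g ε / pos m h ε) + ∫⁻ r in Ioc ε t, F r =
      ENNReal.ofReal (pos m g t / pos m h t) := by
    intro ε hε
    have hposx : ∀ x ∈ Icc ε t, 0 < pos m h x :=
      fun x hx => hh.pos_pos x ⟨hε.1.trans_le hx.1, hx.2.trans (ht.2.trans hbs)⟩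
    have h1 := pos_div_pos_sub hg.integrable hh.integrable hε.2.le hposx
    have h2 : pos m g t / pos m h t = pos m g ε / pos m h ε +
      ∫ r in Ioc ε t, wronskian m g h r / pos m h r ^ 2 := by rw [h1]; ring
    have h3 : ∀ r ∈ Ioc ε t, 0 ≤ wronskian m g h r / pos m h r ^ 2 := fun r hr =>
      div_nonneg (hW r ⟨hε.1.trans hr.1, hr.2.trans ht.2⟩) (by positivity)
    rw [h2, ENNReal.ofReal_add
      (div_nonneg (hnn ε ⟨hε.1, hε.2.le.trans ht.2⟩) (hposx ε ⟨le_rfl, hε.2.le⟩).le)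
      (setIntegral_nonneg (μ := volume) measurableSet_Ioc h3), ofReal_integral_eq_lintegral_ofReal]
    · congr 1
      refine setLIntegral_congr_fun measurableSet_Ioc fun r hr => ?_
      have hr' : r ∈ Ioc 0 b := ⟨hε.1.trans hr.1, hr.2.trans ht.2⟩
      rw [div_eq_mul_one_div, mul_comm (wronskian m g h r), ENNReal.ofReal_mul (by positivity)]
      have hI : IntegrableOn (fun u => (k u - γ u) * (pos m g u * pos m h u)) (Ioc 0 r) m := by
        have i1 := integrableOn_mul_continuous (a := 0) (b := r) hg.integrable ch.continuousOn
        have i2 := integrableOn_mul_continuous (a := 0) (b := r) hh.integrable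
          (continuous_pos hg.integrable).continuousOn
        refine (i1.sub i2).congr_fun (fun u hu => ?_) measurableSet_Ioc
        have hu' : u ∈ Ioc 0 b := ⟨hu.1, hu.2.trans hr'.2⟩
        simp only [Pi.sub_apply]
        rw [hg.eq u hu', hh.eq u ⟨hu'.1, hu'.2.trans hbs⟩]
        ring
      rw [hg.wronskian_eq hh hbs hr', ofReal_integral_eq_lintegral_ofReal hI (hnnr r hr')]
      simp only [hF]
      congr 1
      refine setLIntegral_congr_fun measurableSet_Ioc fun u hu => ?_
      have hu' : u ∈ Ioc 0 b := ⟨hu.1, hu.2.trans hr'.2⟩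
      exact (ofReal_coeff_mul hh ⟨hu'.1, hu'.2.trans hbs⟩ (hnn u hu')).symm
    · exact (intervalIntegrable_iff_integrableOn_Ioc_of_le hε.2.le).1
        (intervalIntegrable_wronskian_div hg.integrable hh.integrable hε.2.le hposx)
    · exact (ae_restrict_iff' measurableSet_Ioc).2 (Eventually.of_forall h3)
  have hun : Ioc 0 t = ⋃ n : ℕ, Ioc (t / ((n : ℝ) + 2)) t := by
    ext x
    simp only [mem_iUnion, mem_Ioc]
    constructor
    · intro hx
      obtain ⟨n, hn⟩ := exists_nat_gt (t / x)
      refine ⟨n, ?_, hx.2⟩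
      rw [div_lt_iff₀ hx.1] at hn
      rw [div_lt_iff₀ (by positivity)]
      nlinarith [hx.1]
    · rintro ⟨n, hn⟩
      exact ⟨lt_trans (div_pos ht.1 (by positivity)) hn.1, hn.2⟩
  have hmono : Monotone fun n : ℕ => Ioc (t / ((n : ℝ) + 2)) t := by
    intro a c hac
    refine Ioc_subset_Ioc_left ?_
    have : (a : ℝ) ≤ c := Nat.cast_le.2 hac
    exact div_le_div_of_nonneg_left ht.1.le (by positivity) (by linarith)
  have hlimF : Tendsto (fun n : ℕ => ∫⁻ r in Ioc (t / ((n : ℝ) + 2)) t, F r) atTop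
      (𝓝 (∫⁻ r in Ioc 0 t, F r)) := by
    rw [hun, setLIntegral_iUnion_of_directed _ hmono.directed_le]
    exact tendsto_atTop_iSup fun a c hac => lintegral_mono_set (hmono hac)
  have hε0 : Tendsto (fun n : ℕ => t / ((n : ℝ) + 2)) atTop (𝓝[>] 0) := by
    refine tendsto_nhdsWithin_iff.2 ⟨?_, Eventually.of_forall fun n => div_pos ht.1 (by positivity)⟩
    exact tendsto_const_nhds.div_atTop
      (tendsto_atTop_add_const_right _ _ tendsto_natCast_atTop_atTop)
  have hlimz : Tendsto (fun n : ℕ => ENNReal.ofReal (pos m g (t / ((n : ℝ) + 2)) /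
      pos m h (t / ((n : ℝ) + 2)))) atTop (𝓝 1) := by
    have := ENNReal.tendsto_ofReal
      ((tendsto_pos_div_pos hg.integrable hh.integrable).comp hε0)
    rwa [ENNReal.ofReal_one] at this
  refine le_of_tendsto' (hlimz.add hlimF) fun n => (key _ ⟨div_pos ht.1 (by positivity), ?_⟩).le
  rw [div_lt_iff₀ (by positivity)]
  nlinarith [ht.1, (Nat.cast_nonneg n : (0 : ℝ) ≤ n)]

/-- Sturm comparison. -/
lemma IsSol.pos_le_pos (hm : ∀ᵐ u ∂m, 0 < u) (hk : Measurable k) (hγ : Measurable γ)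
    (hg : IsSol m k b g) (hh : IsLive m γ s h) (hbs : b ≤ s)
    (hnn : ∀ u ∈ Ioc 0 b, 0 ≤ pos m g u) (hle : ∀ᵐ u ∂m, u ∈ Ioc 0 b → γ u ≤ k u)
    {t : ℝ} (ht : t ∈ Ioc 0 b) : pos m h t ≤ pos m g t := by
  have h1 := le_trans le_self_add (hg.le_ratio hm hk hγ hh hbs hnn hle ht)
  rwa [ENNReal.one_le_ofReal, one_le_div (hh.pos_pos t ⟨ht.1, ht.2.trans hbs⟩)] at h1

/-- The quotient identity started at `0`, where the ratio has limit `1`; integrability near `0` has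
to be assumed because the Wronskian is signed here. -/
lemma setIntegral_wronskian_div (hg : Integrable g m) (hh : IsLive m γ s h) {t : ℝ}
    (ht : t ∈ Ioc 0 s)
    (hintg : IntegrableOn (fun r => wronskian m g h r / pos m h r ^ 2) (Ioc 0 t)) :
    ∫ r in Ioc 0 t, wronskian m g h r / pos m h r ^ 2 = pos m g t / pos m h t - 1 := by
  have hc := intervalIntegral.continuousOn_primitive_interval_left
    (f := fun r => wronskian m g h r / pos m h r ^ 2) (a := 0) (b := t) (μ := volume)
    (by rw [uIcc_of_le ht.1.le, integrableOn_Icc_iff_integrableOn_Ioc]; exact hintg)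
  have h1 := (hc 0 left_mem_uIcc).tendsto
  rw [intervalIntegral.integral_of_le ht.1.le] at h1
  have h2 : Tendsto (fun x => ∫ r in x..t, wronskian m g h r / pos m h r ^ 2) (𝓝[>] 0)
      (𝓝 (∫ r in Ioc 0 t, wronskian m g h r / pos m h r ^ 2)) := by
    refine h1.mono_left (nhdsWithin_le_of_mem ?_)
    rw [uIcc_of_le ht.1.le]
    exact Icc_mem_nhdsGT ht.1
  have h3 : Tendsto (fun x => pos m g t / pos m h t - pos m g x / pos m h x) (𝓝[>] 0)
      (𝓝 (pos m g t / pos m h t - 1)) :=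
    tendsto_const_nhds.sub (tendsto_pos_div_pos hg hh.integrable)
  refine tendsto_nhds_unique h2 (h3.congr' ?_)
  filter_upwards [Ioo_mem_nhdsGT ht.1] with ε hε
  rw [intervalIntegral.integral_of_le hε.2.le, pos_div_pos_sub hg hh.integrable hε.2.le
    fun x hx => hh.pos_pos x ⟨hε.1.trans_le hx.1, hx.2.trans ht.2⟩]

end Comparison

/-! ### Lowering the coefficient of a positive solution. -/

/-- If `h` is a solution of the Jacobi equation, then so is `h * damping m h f`, with the
coefficient lowered by `f / (h² * damping m h f)`. -/
def damping (m : Measure ℝ) (h f : ℝ → ℝ) (t : ℝ) : ℝ :=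
  1 - ∫ r in Ioc 0 t, (∫ u in Ioc 0 r, f u ∂m) / h r ^ 2

section Damping

variable {m : Measure ℝ} {f h : ℝ → ℝ} {c s : ℝ}

lemma integrableOn_one_div_sq (hh : Continuous h) (hpos : ∀ t ∈ Ioc 0 s, 0 < h t) {u t : ℝ}
    (hu : 0 < u) (hts : t ≤ s) : IntegrableOn (fun r => 1 / h r ^ 2) (Icc u t) := by
  refine ContinuousOn.integrableOn_Icc ?_
  exact continuousOn_const.div (hh.pow 2).continuousOn fun r hr =>
    (pow_pos (hpos r ⟨hu.trans_le hr.1, hr.2.trans hts⟩) 2).ne'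

lemma setIntegral_one_div_sq_le (hh : Continuous h) (hc : 0 < c)
    (hle : ∀ t ∈ Ioc 0 s, c * t ≤ h t) {u t : ℝ} (hu : 0 < u) (hut : u ≤ t) (hts : t ≤ s) :
    ∫ r in Ioc u t, 1 / h r ^ 2 ≤ 1 / (c ^ 2 * u) := by
  have hpos : ∀ r ∈ Ioc 0 s, 0 < h r := fun r hr => (mul_pos hc hr.1).trans_le (hle r hr)
  have hcr : ContinuousOn (fun r : ℝ => 1 / (c * r) ^ 2) (Icc u t) :=
    continuousOn_const.div (by fun_prop) fun r hr =>
      (pow_pos (mul_pos hc (hu.trans_le hr.1)) 2).ne'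
  calc ∫ r in Ioc u t, 1 / h r ^ 2 ≤ ∫ r in Ioc u t, 1 / (c * r) ^ 2 := by
        refine setIntegral_mono_on
          ((integrableOn_one_div_sq hh hpos hu hts).mono_set Ioc_subset_Icc_self)
          (hcr.integrableOn_Icc.mono_set Ioc_subset_Icc_self) measurableSet_Ioc fun r hr => ?_
        have hr0 : 0 < r := hu.trans hr.1
        exact one_div_le_one_div_of_le (by positivity)
          (pow_le_pow_left₀ (by positivity) (hle r ⟨hr0, hr.2.trans hts⟩) 2)
    _ = -1 / (c ^ 2 * t) - -1 / (c ^ 2 * u) := by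
        rw [← intervalIntegral.integral_of_le hut]
        refine intervalIntegral.integral_eq_sub_of_hasDerivAt (f := fun r => -1 / (c ^ 2 * r)) ?_ ?_
        · intro r hr
          rw [uIcc_of_le hut] at hr
          have hr0 : r ≠ 0 := (hu.trans_le hr.1).ne'
          have hc0 : c ≠ 0 := hc.ne'
          have := (hasDerivAt_const r (-1 : ℝ)).div ((hasDerivAt_id r).const_mul (c ^ 2))
            (by simp [hr0, hc0])
          refine this.congr_deriv ?_
          simp only [id]
          field_simp
          ring
        · rw [intervalIntegrable_iff_integrableOn_Ioc_of_le hut]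
          exact hcr.integrableOn_Icc.mono_set Ioc_subset_Icc_self
    _ ≤ 1 / (c ^ 2 * u) := by
        have : 0 < 1 / (c ^ 2 * t) := by
          have := hu.trans_le hut
          positivity
        rw [neg_div, neg_div]
        linarith

/-- The bound `h t ≥ c t` gives `∫_u^t h⁻² ≤ 1 / (c² u)`; this is why integrability is imposed on `f
u / u`. -/
lemma integrable_triangle (hh : Continuous h) (hc : 0 < c)
    (hle : ∀ t ∈ Ioc 0 s, c * t ≤ h t) (hf0 : ∀ u, 0 ≤ f u) (hfm : AEStronglyMeasurable f m)
    (hf : Integrable (fun u => f u / u) m) {t : ℝ} (hts : t ≤ s) :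
    Integrable ({x : ℝ × ℝ | x.1 ≤ x.2}.indicator fun x => f x.1 * (1 / h x.2 ^ 2))
      ((m.restrict (Ioc 0 t)).prod (volume.restrict (Ioc 0 t))) := by
  have hpos : ∀ r ∈ Ioc 0 s, 0 < h r := fun r hr => (mul_pos hc hr.1).trans_le (hle r hr)
  have hmeas : Measurable fun r => 1 / h r ^ 2 := measurable_const.div (hh.measurable.pow_const 2)
  have hasm : AEStronglyMeasurable
      ({x : ℝ × ℝ | x.1 ≤ x.2}.indicator fun x => f x.1 * (1 / h x.2 ^ 2))
      ((m.restrict (Ioc 0 t)).prod (volume.restrict (Ioc 0 t))) :=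
    (hfm.restrict.comp_fst.mul
      (hmeas.comp measurable_snd).aestronglyMeasurable).indicator measurableSet_triangle
  have hsec : ∀ u ∈ Ioc 0 t, (fun r => {x : ℝ × ℝ | x.1 ≤ x.2}.indicator
      (fun x => f x.1 * (1 / h x.2 ^ 2)) (u, r)) = (Ici u).indicator fun r => f u * (1 / h r ^ 2) := by
    intro u hu
    rfl
  have hIcc : ∀ u ∈ Ioc 0 t, Ici u ∩ Ioc 0 t = Icc u t := by
    intro u hu
    ext r
    simp only [mem_Icc, mem_inter_iff, mem_Ici, mem_Ioc]
    exact ⟨fun h => ⟨h.1, h.2.2⟩, fun h => ⟨h.1, hu.1.trans_le h.1, h.2⟩⟩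
  rw [integrable_prod_iff hasm]
  constructor
  · refine (ae_restrict_iff' measurableSet_Ioc).2 (Eventually.of_forall fun u hu => ?_)
    rw [hsec u hu, integrable_indicator_iff measurableSet_Ici, IntegrableOn,
      Measure.restrict_restrict measurableSet_Ici, hIcc u hu]
    exact (integrableOn_one_div_sq hh hpos hu.1 hts).const_mul _
  · refine Integrable.mono' (g := fun u => 1 / c ^ 2 * (f u / u)) (hf.restrict.const_mul _)
      hasm.norm.integral_prod_right' ?_
    refine (ae_restrict_iff' measurableSet_Ioc).2 (Eventually.of_forall fun u hu => ?_)
    have e : ∫ r in Ioc 0 t, ‖{x : ℝ × ℝ | x.1 ≤ x.2}.indicator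
        (fun x => f x.1 * (1 / h x.2 ^ 2)) (u, r)‖ = f u * ∫ r in Ioc u t, 1 / h r ^ 2 := by
      rw [← integral_Icc_eq_integral_Ioc (x := u), ← hIcc u hu,
        ← Measure.restrict_restrict measurableSet_Ici, ← integral_const_mul,
        ← integral_indicator measurableSet_Ici]
      refine integral_congr_ae (Eventually.of_forall fun r => ?_)
      by_cases hr : u ≤ r
      · simp only [indicator, mem_ofPred_eq, hr, if_true, mem_Ici]
        exact Real.norm_of_nonneg (mul_nonneg (hf0 u) (by positivity))
      · simp [indicator, hr]
    rw [e, Real.norm_of_nonneg (mul_nonneg (hf0 u) (integral_nonneg fun r => by positivity))]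
    have hu0 := hu.1
    calc f u * ∫ r in Ioc u t, 1 / h r ^ 2 ≤ f u * (1 / (c ^ 2 * u)) :=
          mul_le_mul_of_nonneg_left (setIntegral_one_div_sq_le hh hc hle hu.1 hu.2 hts) (hf0 u)
      _ = 1 / c ^ 2 * (f u / u) := by field_simp

lemma damping_zero : damping m h f 0 = 1 := by simp [damping]

variable [SFinite m]

lemma integrableOn_div_sq (hh : Continuous h) (hc : 0 < c)
    (hle : ∀ t ∈ Ioc 0 s, c * t ≤ h t) (hf0 : ∀ u, 0 ≤ f u) (hfm : AEStronglyMeasurable f m)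
    (hf : Integrable (fun u => f u / u) m) :
    IntegrableOn (fun r => (∫ u in Ioc 0 r, f u ∂m) / h r ^ 2) (Ioc 0 s) := by
  have := (integrable_triangle hh hc hle hf0 hfm hf le_rfl).integral_prod_right
  refine IntegrableOn.congr_fun this (fun r hr => ?_) measurableSet_Ioc
  have e : Ioc 0 r = Iic r ∩ Ioc 0 s := by
    ext u
    simp only [mem_inter_iff, mem_Iic, mem_Ioc]
    exact ⟨fun h => ⟨h.2, h.1, h.2.trans hr.2⟩, fun h => ⟨h.2.1, h.1⟩⟩
  rw [div_eq_mul_one_div, ← integral_mul_const, e, ← Measure.restrict_restrict measurableSet_Iic,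
    ← integral_indicator measurableSet_Iic]
  rfl

/-- Guarantees that a sufficiently small `f` keeps the damping factor positive up to `s`, as
`IsLive.exists_damped` requires. -/
lemma one_sub_damping_le (hh : Continuous h) (hc : 0 < c)
    (hle : ∀ t ∈ Ioc 0 s, c * t ≤ h t) (hf0 : ∀ u, 0 ≤ f u) (hfm : AEStronglyMeasurable f m)
    (hf : Integrable (fun u => f u / u) m) (hm : ∀ᵐ u ∂m, u ∈ Ioc 0 s) {t : ℝ} (hts : t ≤ s) :
    1 - damping m h f t ≤ 1 / c ^ 2 * ∫ u, f u / u ∂m := by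
  have hsw := setIntegral_triangle_swap (φ := fun r => 1 / h r ^ 2) (integrable_triangle hh hc hle hf0 hfm hf hts)
  have e : 1 - damping m h f t = ∫ r in Ioc 0 t, 1 / h r ^ 2 * ∫ u in Ioc 0 r, f u ∂m := by
    rw [damping, sub_sub_cancel]
    refine integral_congr_ae (Eventually.of_forall fun r => ?_)
    simp only
    ring
  have hnn : 0 ≤ᵐ[m] fun u => f u / u := by
    filter_upwards [hm] with u hu using div_nonneg (hf0 u) hu.1.le
  have hbound : ∀ u ∈ Ioc 0 t, f u * ∫ r in Ioc u t, 1 / h r ^ 2 ≤ 1 / c ^ 2 * (f u / u) := by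
    intro u hu
    have hu0 := hu.1
    calc f u * ∫ r in Ioc u t, 1 / h r ^ 2 ≤ f u * (1 / (c ^ 2 * u)) :=
          mul_le_mul_of_nonneg_left (setIntegral_one_div_sq_le hh hc hle hu.1 hu.2 hts) (hf0 u)
      _ = 1 / c ^ 2 * (f u / u) := by field_simp
  rw [e, ← hsw, ← integral_const_mul]
  refine le_trans ?_ (setIntegral_le_integral (s := Ioc 0 t) (hf.const_mul (1 / c ^ 2))
    (hnn.mono fun u hu => mul_nonneg (by positivity) hu))
  refine integral_mono_of_nonneg (Eventually.of_forall fun u =>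
    mul_nonneg (hf0 u) (integral_nonneg fun r => by positivity)) (hf.restrict.const_mul _) ?_
  exact (ae_restrict_iff' measurableSet_Ioc).2 (Eventually.of_forall hbound)

lemma damping_antitoneOn (hh : Continuous h) (hc : 0 < c)
    (hle : ∀ t ∈ Ioc 0 s, c * t ≤ h t) (hf0 : ∀ u, 0 ≤ f u) (hfm : AEStronglyMeasurable f m)
    (hf : Integrable (fun u => f u / u) m) : AntitoneOn (damping m h f) (Iic s) := by
  intro a _ b hb hab
  have hi := integrableOn_div_sq hh hc hle hf0 hfm hf
  refine sub_le_sub_left (setIntegral_mono_set (hi.mono_set (Ioc_subset_Ioc_right hb))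
    (Eventually.of_forall fun r => div_nonneg (integral_nonneg fun u => hf0 u) (by positivity))
    (Ioc_subset_Ioc_right hab).eventuallyLE) _

lemma measurable_damping (hh : Measurable h) (hfm : AEStronglyMeasurable f m) :
    Measurable (damping m h f) :=
  measurable_const.sub (measurable_setIntegral_Ioc (((measurable_setIntegral_Ioc hfm 0).div
    (hh.pow_const 2)).aestronglyMeasurable) 0)

/-- Lowering the coefficient of a positive solution. -/
lemma IsLive.exists_damped {k g : ℝ → ℝ} (hg : IsLive m k s g) (hs : 0 < s)
    (hm : ∀ᵐ u ∂m, u ∈ Ioc 0 s) (hf0 : ∀ u, 0 ≤ f u) (hfm : AEStronglyMeasurable f m)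
    (hf : Integrable (fun u => f u / u) m) (hZ : 0 < damping m (pos m g) f s) :
    ∃ g', IsLive m (fun u => k u - f u / (pos m g u ^ 2 * damping m (pos m g) f u)) s g' ∧
      ∀ t ∈ Icc 0 s, pos m g' t = pos m g t * damping m (pos m g) f t := by
  obtain ⟨c, hc, hle⟩ := exists_mul_le_pos hg.integrable hs hg.pos_pos
  set h := pos m g with hh_def
  set Z := damping m h f with hZ_def
  set ω : ℝ → ℝ := fun r => ∫ u in Ioc 0 r, f u ∂m with hω_def
  have hh : Continuous h := continuous_pos hg.integrable
  have hres : m.restrict (Ioc 0 s) = m := Measure.restrict_eq_self_of_ae_mem hm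
  have hωm : Measurable ω := measurable_setIntegral_Ioc hfm 0
  have hωi : IntegrableOn (fun r => ω r / h r ^ 2) (Ioc 0 s) :=
    integrableOn_div_sq hh hc hle hf0 hfm hf
  have hZpos : ∀ t ∈ Icc 0 s, 0 < Z t := fun t ht =>
    hZ.trans_le (damping_antitoneOn hh hc hle hf0 hfm hf ht.2 (mem_Iic.2 le_rfl) ht.2)
  have hωii : IntervalIntegrable (fun r => ω r / h r ^ 2) volume 0 s :=
    (intervalIntegrable_iff_integrableOn_Ioc_of_le hs.le).2 hωi
  have hZcont : ContinuousOn Z (Icc 0 s) := by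
    have := intervalIntegral.continuousOn_primitive (f := fun r => ω r / h r ^ 2) (a := 0) (b := s)
      (μ := volume) (by rwa [integrableOn_Icc_iff_integrableOn_Ioc])
    exact continuousOn_const.sub this
  have hfint : Integrable f m := by
    have := integrableOn_mul_continuous (a := 0) (b := s) hf (Z := fun u => u) continuousOn_id
    rw [IntegrableOn, hres] at this
    refine this.congr ?_
    filter_upwards [hm] with u hu
    exact div_mul_cancel₀ _ hu.1.ne'
  have hfh : Integrable (fun u => f u / h u) m := by
    refine Integrable.mono' (hf.const_mul (1 / c))
      (hfm.mul (hh.measurable.inv.aestronglyMeasurable)) ?_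
    filter_upwards [hm] with u hu
    have h1 := hle u hu
    have h2 := hg.pos_pos u hu
    have h3 := mul_pos hc hu.1
    rw [Real.norm_of_nonneg (div_nonneg (hf0 u) h2.le)]
    calc f u / h u ≤ f u / (c * u) := div_le_div_of_nonneg_left (hf0 u) h3 h1
      _ = 1 / c * (f u / u) := by ring
  have hgZ : Integrable (fun u => g u * Z u) m := by
    have := integrableOn_mul_continuous hg.integrable hZcont
    rwa [IntegrableOn, hres] at this
  set g' : ℝ → ℝ := fun u => g u * Z u - f u / h u with hg'_def
  have hg' : Integrable g' m := hgZ.sub hfh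
  have hvel : ∀ t ∈ Ioc 0 s, vel m g' t = vel m g t * Z t - ω t / h t := by
    intro t ht
    have e1 := vel_mul_eq hg.integrable ht.1.le (φ := fun r => -(ω r / h r ^ 2)) (Z := Z)
      (hωi.mono_set (Ioc_subset_Ioc_right ht.2)).neg
      (fun u _ => by
        rw [hZ_def, damping_zero, integral_neg]
        exact sub_eq_add_neg _ _)
      hgZ.integrableOn
    have htri := integrable_triangle hh hc hle hf0 hfm hf ht.2
    have htri' : Integrable ({x : ℝ × ℝ | x.1 ≤ x.2}.indicator
        fun x => f x.1 * (vel m g x.2 / h x.2 ^ 2))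
        ((m.restrict (Ioc 0 t)).prod (volume.restrict (Ioc 0 t))) := by
      have := htri.mul_bdd (g := fun x : ℝ × ℝ => vel m g x.2) (c := 1 + ∫ u, |g u| ∂m)
        ((measurable_vel hg.integrable).comp measurable_snd).aestronglyMeasurable
        (Eventually.of_forall fun x => (Real.norm_eq_abs _).le.trans (abs_vel_le hg.integrable _))
      refine this.congr (Eventually.of_forall fun x => ?_)
      by_cases hx : x.1 ≤ x.2
      · simp only [indicator, mem_ofPred_eq, hx, if_true]; ring
      · simp [indicator, hx]
    have e2 := setIntegral_triangle_swap (φ := fun r => vel m g r / h r ^ 2) htri'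
    -- The inner integral is `1 / h u - 1 / h t`, because `-1 / h` is a primitive of `h' / h²`.
    have e3 : ∫ u in Ioc 0 t, f u * ∫ r in Ioc u t, vel m g r / h r ^ 2 ∂volume ∂m =
        ∫ u in Ioc 0 t, (f u / h u - f u * (1 / h t)) ∂m := by
      refine setIntegral_congr_fun measurableSet_Ioc fun u hu => ?_
      have hne : ∀ x ∈ Icc u t, h x ≠ 0 := fun x hx =>
        (hg.pos_pos x ⟨hu.1.trans_le hx.1, hx.2.trans ht.2⟩).ne'
      have := intervalIntegral.integral_eq_sub_of_hasDeriv_right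
        (f := fun x => -(h x)⁻¹) (f' := fun x => vel m g x / h x ^ 2) (a := u) (b := t) ?_ ?_ ?_
      · rw [intervalIntegral.integral_of_le hu.2] at this
        rw [this]
        ring
      · rw [uIcc_of_le hu.2]
        exact (hh.continuousOn.inv₀ hne).neg
      · intro x hx
        rw [min_eq_left hu.2, max_eq_right hu.2] at hx
        have hd := ((hasDerivWithinAt_pos hg.integrable x).inv
          (hne x (Ioo_subset_Icc_self hx))).neg
        refine hd.congr_deriv ?_
        rw [neg_div, neg_neg]
      · simp only [div_eq_mul_inv]
        refine (intervalIntegrable_vel hg.integrable u t).mul_continuousOn ?_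
        rw [uIcc_of_le hu.2]
        exact (hh.pow 2).continuousOn.inv₀ fun x hx => pow_ne_zero 2 (hne x hx)
    rw [integral_sub hfh.integrableOn (hfint.integrableOn.mul_const _), integral_mul_const] at e3
    have e4 : ∫ r in Ioc 0 t, vel m g r * -(ω r / h r ^ 2) =
        -∫ r in Ioc 0 t, vel m g r / h r ^ 2 * ∫ u in Ioc 0 r, f u ∂m := by
      rw [← integral_neg]
      refine integral_congr_ae (Eventually.of_forall fun r => ?_)
      simp only [hω_def]
      ring
    rw [e4, ← e2, e3, hZ_def, damping_zero] at e1
    rw [hZ_def, e1, vel, hg'_def, integral_sub hgZ.integrableOn hfh.integrableOn]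
    simp only [hω_def]
    ring
  have hpos : ∀ t ∈ Icc 0 s, pos m g' t = h t * Z t := by
    intro t ht
    have hsub : Icc 0 t ⊆ Icc 0 s := Icc_subset_Icc_right ht.2
    have := intervalIntegral.integral_eq_sub_of_hasDeriv_right
      (f := fun x => h x * Z x) (f' := vel m g') (a := 0) (b := t) ?_ ?_
      (intervalIntegrable_vel hg' 0 t)
    · rw [pos, this, hh_def, pos_zero, zero_mul, sub_zero]
    · rw [uIcc_of_le ht.1]
      exact hh.continuousOn.mul (hZcont.mono hsub)
    · intro x hx
      rw [min_eq_left ht.1, max_eq_right ht.1] at hx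
      have hxs : x ∈ Ioc 0 s := ⟨hx.1, hx.2.le.trans ht.2⟩
      have hhx : 0 < h x := hg.pos_pos x hxs
      have hZd : HasDerivWithinAt Z (-(ω x / h x ^ 2)) (Ioi x) x := by
        have h1 : HasDerivWithinAt (fun y => ∫ r in (0 : ℝ)..y, ω r / h r ^ 2) (ω x / h x ^ 2)
            (Ici x) x := by
          refine intervalIntegral.integral_hasDerivWithinAt_right
            (hωii.mono_set ?_) ?_ ?_
          · rw [uIcc_of_le hs.le, uIcc_of_le hx.1.le]
            exact Icc_subset_Icc_right hxs.2
          · exact (hωm.div (hh.measurable.pow_const 2)).stronglyMeasurable.stronglyMeasurableAtFilter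
          · exact ((continuousWithinAt_setIntegral_Ioc hfint 0 x).mono Ioi_subset_Ici_self).div
              (hh.pow 2).continuousWithinAt (pow_pos hhx 2).ne'
        have h2 := (h1.mono Ioi_subset_Ici_self).const_sub 1
        refine h2.congr (fun y hy => ?_) ?_
        · rw [intervalIntegral.integral_of_le (hx.1.le.trans (le_of_lt hy))]; rfl
        · rw [intervalIntegral.integral_of_le hx.1.le]; rfl
      refine ((hasDerivWithinAt_pos hg.integrable x).mul hZd).congr_deriv ?_
      rw [hvel x hxs, ← hh_def]
      field_simp
      ring
  refine ⟨g', ⟨⟨hg', fun u hu => ?_⟩, fun u hu => ?_⟩, hpos⟩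
  · have h1 : 0 < h u := hg.pos_pos u hu
    have h2 := hZpos u (Ioc_subset_Icc_self hu)
    rw [hpos u (Ioc_subset_Icc_self hu), hg'_def]
    simp only
    rw [hg.eq u hu, ← hh_def]
    field_simp
  · rw [hpos u (Ioc_subset_Icc_self hu)]
    exact mul_pos (hg.pos_pos u hu) (hZpos u (Ioc_subset_Icc_self hu))

end Damping

/-! ### Stopped solutions. -/

/-- `j` coincides on `(0, s]` with the motion `pos m g`, which solves the Jacobi equation with
coefficient `k · m`, stopped at its first zero `b`. -/
structure StoppedAt (m : Measure ℝ) (k : ℝ → ℝ) (s : ℝ) (j : ℝ → ℝ) (b : ℝ) (g : ℝ → ℝ) :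
    Prop where
  mem : b ∈ Ioc 0 s
  sol : IsSol m k b g
  eq : ∀ u ∈ Ioc 0 b, j u = pos m g u
  pos_pos : ∀ u ∈ Ioo 0 b, 0 < pos m g u
  pos_end : 0 ≤ pos m g b
  endpoint : b = s ∨ pos m g b = 0
  after : ∀ u ∈ Ioc b s, j u = 0

lemma IsStoppedSolution.exists_stoppedAt {ν : Measure ℝ} [IsLocallyFiniteMeasure ν]
    {k j : ℝ → ℝ} {t₀ s : ℝ} (h : IsStoppedSolution ν k t₀ j) (hs : s ∈ Ioc 0 t₀) :
    ∃ b g, StoppedAt (ν.restrict (Ioc 0 s)) k s j b g := by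
  obtain ⟨b₀, hb₀, ⟨v, hsol⟩, hpos, hlast, hafter⟩ := h
  set m := ν.restrict (Ioc 0 s) with hm
  set b := min b₀ s with hb
  have hb0 : 0 < b := lt_min hb₀.1 hs.1
  have hbb : b ≤ b₀ := min_le_left _ _
  have hbs : b ≤ s := min_le_right _ _
  have hj0 : j 0 = 0 := by
    rw [hsol.position 0 ⟨le_rfl, hb₀.1.le⟩, intervalIntegral.integral_same]
  set g : ℝ → ℝ := (Ioc 0 b).indicator fun u => k u * j u with hg
  have hgi : Integrable g m := by
    rw [hg, integrable_indicator_iff measurableSet_Ioc]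
    refine Integrable.mono_measure (hsol.integrable.mono_set ?_) (Measure.restrict_mono_measure
      Measure.restrict_le_self _)
    exact fun u hu => ⟨hu.1.le, hu.2.trans hbb⟩
  have hvel : ∀ t ∈ Icc 0 b, vel m g t = v t := by
    intro t ht
    rw [hsol.velocity t ⟨ht.1, ht.2.trans hbb⟩, vel]
    congr 1
    have e1 : ∫ u in Ioc 0 t, g u ∂m = ∫ u in Ioc 0 t, k u * j u ∂ν := by
      rw [hm, Measure.restrict_restrict measurableSet_Ioc,
        inter_eq_left.2 (Ioc_subset_Ioc_right (ht.2.trans hbs))]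
      refine setIntegral_congr_fun measurableSet_Ioc fun u hu => ?_
      exact indicator_of_mem (show u ∈ Ioc 0 b from ⟨hu.1, hu.2.trans ht.2⟩) _
    rw [e1]
    -- A possible atom of `ν` at `0` has no effect because `j 0 = 0`, so `[0, t]` may be replaced by
    -- `(0, t]`.
    refine (setIntegral_eq_of_subset_of_forall_sdiff_eq_zero measurableSet_Icc
      Ioc_subset_Icc_self fun u hu => ?_).symm
    have : u = 0 := by
      by_contra hne
      exact hu.2 ⟨lt_of_le_of_ne hu.1.1 (Ne.symm hne), hu.1.2⟩
    rw [this, hj0, mul_zero]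
  have heq : ∀ t ∈ Icc 0 b, j t = pos m g t := by
    intro t ht
    rw [hsol.position t ⟨ht.1, ht.2.trans hbb⟩, pos]
    refine intervalIntegral.integral_congr fun u hu => ?_
    rw [uIcc_of_le ht.1] at hu
    exact (hvel u ⟨hu.1, hu.2.trans ht.2⟩).symm
  have hpos' : ∀ u ∈ Ioo 0 b, 0 < pos m g u := fun u hu => by
    rw [← heq u (Ioo_subset_Icc_self hu)]
    exact hpos u ⟨hu.1, hu.2.trans_le hbb⟩
  refine ⟨b, g, ⟨hb0, hbs⟩, ⟨hgi, fun u hu => ?_⟩, fun u hu => heq u (Ioc_subset_Icc_self hu), hpos',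
    ?_, ?_, fun u hu => ?_⟩
  · rw [← heq u (Ioc_subset_Icc_self hu)]
    exact indicator_of_mem hu _
  · have hc : ContinuousWithinAt (pos m g) (Ioo 0 b) b :=
      (continuous_pos hgi).continuousWithinAt
    have : (𝓝[Ioo 0 b] b).NeBot := by
      rw [← mem_closure_iff_nhdsWithin_neBot, closure_Ioo hb0.ne]
      exact ⟨hb0.le, le_rfl⟩
    refine ge_of_tendsto hc.tendsto ?_
    filter_upwards [self_mem_nhdsWithin] with u hu using (hpos' u hu).le
  · rcases le_total s b₀ with h | h
    · exact Or.inl (min_eq_right h)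
    · have hbe : b = b₀ := min_eq_left h
      rcases hlast with h' | h'
      · exact Or.inl (le_antisymm hbs (by rw [hbe, h']; exact hs.2))
      · exact Or.inr (by rw [← heq b ⟨hb0.le, le_rfl⟩, hbe]; exact h')
  · rcases le_total s b₀ with h | h
    · have hbe : b = s := min_eq_right h
      rw [hbe] at hu
      exact absurd hu.1 (not_lt.2 hu.2)
    · have hbe : b = b₀ := min_eq_left h
      rw [hbe] at hu
      exact hafter u ⟨hu.1, hu.2.trans hs.2⟩

section Stopped

variable {m : Measure ℝ} {k γ : ℝ → ℝ} {s b : ℝ} {j g h : ℝ → ℝ}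

lemma StoppedAt.pos_nonneg (hj : StoppedAt m k s j b g) : ∀ u ∈ Ioc 0 b, 0 ≤ pos m g u := by
  intro u hu
  rcases eq_or_lt_of_le hu.2 with rfl | hlt
  · exact hj.pos_end
  · exact (hj.pos_pos u ⟨hu.1, hlt⟩).le

lemma StoppedAt.nonneg (hj : StoppedAt m k s j b g) {u : ℝ} (hu : u ∈ Ioc 0 s) : 0 ≤ j u := by
  rcases le_or_gt u b with h | h
  · rw [hj.eq u ⟨hu.1, h⟩]
    exact hj.pos_nonneg u ⟨hu.1, h⟩
  · exact (hj.after u ⟨h, hu.2⟩).ge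

lemma StoppedAt.eq_end (hj : StoppedAt m k s j b g) (h : 0 < j s) : b = s := by
  by_contra hne
  exact h.ne' (hj.after s ⟨lt_of_le_of_ne hj.mem.2 hne, le_rfl⟩)

lemma StoppedAt.isLive (hj : StoppedAt m k s j b g) (h : 0 < j s) : IsLive m k s g := by
  have hb := hj.eq_end h
  subst hb
  refine ⟨hj.sol, fun u hu => ?_⟩
  rcases eq_or_lt_of_le hu.2 with rfl | hlt
  · rwa [← hj.eq u hu]
  · exact hj.pos_pos u ⟨hu.1, hlt⟩

lemma StoppedAt.pos_end_eq_zero (hj : StoppedAt m k s j b g) (h : j s = 0) : pos m g b = 0 := by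
  rcases hj.endpoint with rfl | h'
  · rw [← hj.eq b ⟨hj.mem.1, le_rfl⟩, h]
  · exact h'

lemma tsum_neumann_eq_one {K : ℝ → ℝ → ℝ≥0∞} {q : ℝ → ℝ} (hq : ∀ᵐ u ∂m, q u ≤ 0) (t : ℝ) :
    ∑' n, neumann m K q n t = 1 := by
  rw [tsum_eq_single 0]
  · rfl
  · intro n hn
    obtain ⟨n, rfl⟩ := Nat.exists_eq_succ_of_ne_zero hn
    simp only [neumann]
    rw [lintegral_congr_ae (g := fun _ => 0), lintegral_zero]
    filter_upwards [hq] with u hu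
    rw [ENNReal.ofReal_of_nonpos hu, zero_mul, mul_zero]

variable [SFinite m]

/-- Survival passes to larger coefficients: Sturm comparison at `b` makes the end value positive, so
the motion cannot have stopped at a zero. -/
lemma StoppedAt.lt_of_isLive (hm : ∀ᵐ u ∂m, u ∈ Ioc 0 s) (hk : Measurable k) (hγ : Measurable γ)
    (hj : StoppedAt m k s j b g) (hh : IsLive m γ s h) (hle : ∀ᵐ u ∂m, γ u ≤ k u) :
    0 < j s := by
  have hle' := hj.sol.pos_le_pos (hm.mono fun u hu => hu.1) hk hγ hh hj.mem.2 hj.pos_nonneg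
    (hle.mono fun u hu _ => hu) ⟨hj.mem.1, le_rfl⟩
  have hpb : 0 < pos m g b := (hh.pos_pos b hj.mem).trans_le hle'
  rcases hj.endpoint with rfl | h'
  · rwa [hj.eq b ⟨hj.mem.1, le_rfl⟩]
  · exact absurd h' hpb.ne'

lemma aemeasurable_neumann_integrand (hh : Integrable h m) {q : ℝ → ℝ} (hq : Measurable q)
    (n : ℕ) (t : ℝ) : AEMeasurable (fun u => kernel (pos m h) t u *
      (ENNReal.ofReal (q u) * neumann m (kernel (pos m h)) q n u)) m := by
  have hK := measurable_kernel (continuous_pos hh)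
  have h1 := measurable_neumann (T := Unit) (ν := m) hK (q := fun _ u => q u)
    (hq.comp measurable_snd) n
  have h2 : Measurable fun u => neumann m (kernel (pos m h)) q n u :=
    h1.comp (measurable_prodMk_left (x := ()))
  have h3 : Measurable fun u => kernel (pos m h) t u := hK.comp measurable_prodMk_left
  exact (h3.mul (hq.ennreal_ofReal.mul h2)).aemeasurable

/-- A stopped solution is dominated by the Neumann series relative to any positive solution. -/
lemma StoppedAt.le_tsum (hm : ∀ᵐ u ∂m, u ∈ Ioc 0 s) (hs : 0 < s) (hk : Measurable k)
    (hγ : Measurable γ) (hj : StoppedAt m k s j b g) (hh : IsLive m γ s h) :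
    ENNReal.ofReal (j s / pos m h s) ≤
      ∑' n, neumann m (kernel (pos m h)) (fun u => k u - γ u) n s := by
  obtain ⟨c, hc, hle⟩ := exists_mul_le_pos hh.integrable hs hh.pos_pos
  refine le_tsum_neumann (S := Ioc 0 s) hm (z := fun t => ENNReal.ofReal (j t / pos m h t))
    (C := ENNReal.ofReal ((1 + ∫ u, |g u| ∂m) / c)) ENNReal.ofReal_ne_top
    (fun n t => aemeasurable_neumann_integrand hh.integrable (hk.sub hγ) n t) ?_ ?_ ⟨hs, le_rfl⟩
  · intro t ht
    rcases le_or_gt t b with htb | htb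
    · have h1 := hj.sol.ratio_le (hm.mono fun u hu => hu.1) hk hγ hh hj.mem.2 hj.pos_nonneg
        ⟨ht.1, htb⟩
      rw [hj.eq t ⟨ht.1, htb⟩]
      refine h1.trans_eq ?_
      congr 1
      refine lintegral_congr_ae ?_
      filter_upwards [hm] with u hu
      rcases le_or_gt u t with hut | hut
      · rw [hj.eq u ⟨hu.1, hut.trans htb⟩]
        rfl
      -- The kernel vanishes for `u > t`, so the equation before the stopping time does not see that
      -- `j` and the motion differ later.
      · rw [kernel_of_lt hut, zero_mul, zero_mul]
    · rw [hj.after t ⟨htb, ht.2⟩, zero_div, ENNReal.ofReal_zero]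
      exact zero_le
  · intro t ht
    refine ENNReal.ofReal_le_ofReal ?_
    have hC : 0 ≤ 1 + ∫ u, |g u| ∂m := add_nonneg zero_le_one (integral_nonneg fun u => abs_nonneg _)
    rcases le_or_gt t b with htb | htb
    · rw [hj.eq t ⟨ht.1, htb⟩, div_le_div_iff₀ (hh.pos_pos t ht) hc]
      have h1 := (le_abs_self _).trans (abs_pos_le (g := g) hj.sol.integrable ht.1.le)
      calc pos m g t * c ≤ (1 + ∫ u, |g u| ∂m) * t * c := by gcongr
        _ = (1 + ∫ u, |g u| ∂m) * (c * t) := by ring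
        _ ≤ _ := by gcongr; exact hle t ht
    · rw [hj.after t ⟨htb, ht.2⟩, zero_div]
      positivity

/-- The Neumann series is dominated by a positive solution with a larger coefficient. -/
lemma IsLive.tsum_le (hm : ∀ᵐ u ∂m, u ∈ Ioc 0 s) (hs : 0 < s) {k' : ℝ → ℝ} (hk : Measurable k)
    (hk' : Measurable k') (hγ : Measurable γ) (hg : IsLive m k s g) (hh : IsLive m γ s h)
    (hle : ∀ᵐ u ∂m, γ u ≤ k u) (hle' : ∀ᵐ u ∂m, k' u ≤ k u) :
    ∑' n, neumann m (kernel (pos m h)) (fun u => k' u - γ u) n s ≤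
      ENNReal.ofReal (pos m g s / pos m h s) := by
  refine tsum_neumann_le (S := Ioc 0 s) hm (z := fun t => ENNReal.ofReal (pos m g t / pos m h t))
    (fun n t => aemeasurable_neumann_integrand hh.integrable (hk'.sub hγ) n t) ?_ ⟨hs, le_rfl⟩
  intro t ht
  refine le_trans ?_ (hg.le_ratio (hm.mono fun u hu => hu.1) hk hγ hh le_rfl
    (fun u hu => (hg.pos_pos u hu).le) (hle.mono fun u hu _ => hu) ht)
  gcongr 1 + ?_
  refine lintegral_mono_ae ?_
  filter_upwards [hle'] with u hu
  gcongr
  exact sub_le_sub_right hu _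

/-- Between a solution that has died by time `s` and one that has not, there are positive
solutions that are as small as we like at time `s`. -/
lemma StoppedAt.exists_between {k₁ k₂ g₁ g₂ : ℝ → ℝ} (hm : ∀ᵐ u ∂m, u ∈ Ioc 0 s)
    (hk₁ : Measurable k₁) (hk₂ : Measurable k₂) (h₁ : StoppedAt m k₁ s j b g₁) (hdead : j s = 0)
    (h₂ : IsLive m k₂ s g₂) (hle : ∀ᵐ u ∂m, k₁ u ≤ k₂ u) {ε : ℝ} (hε : ε ∈ Ioo 0 1) :
    ∃ γ h, Measurable γ ∧ IsLive m γ s h ∧ (∀ᵐ u ∂m, k₁ u ≤ γ u) ∧ (∀ᵐ u ∂m, γ u ≤ k₂ u) ∧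
      pos m h s = ε * pos m g₂ s := by
  have hs : 0 < s := h₁.mem.1.trans_le h₁.mem.2
  have hbs := h₁.mem.2
  have hc₁ := continuous_pos h₁.sol.integrable
  have hc₂ := continuous_pos h₂.integrable
  obtain ⟨c, hc, hcle⟩ := exists_mul_le_pos h₂.integrable hs h₂.pos_pos
  set C₁ := 1 + ∫ u, |g₁ u| ∂m with hC₁
  set C₂ := 1 + ∫ u, |g₂ u| ∂m with hC₂
  have hC₁0 : 0 ≤ C₁ := add_nonneg zero_le_one (integral_nonneg fun u => abs_nonneg _)
  have hC₂0 : 0 ≤ C₂ := add_nonneg zero_le_one (integral_nonneg fun u => abs_nonneg _)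
  -- The dying solution is reached from `pos m g₂` by damping with `f` below, whose integral `ω` is
  -- minus the Wronskian on `(0, b]`. Damping by a smaller multiple `a * f` gives intermediate
  -- solutions. The absolute value in `f` keeps it nonnegative off `(0, s]` too.
  set J : ℝ → ℝ := (Ioc 0 b).indicator (pos m g₁) with hJ
  have hJm : Measurable J := hc₁.measurable.indicator measurableSet_Ioc
  have hJ0 : ∀ u, 0 ≤ J u := fun u => indicator_nonneg (fun u hu => h₁.pos_nonneg u hu) u
  have hJC : ∀ u ∈ Ioc 0 s, J u ≤ C₁ * u := by
    intro u hu
    by_cases hub : u ∈ Ioc 0 b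
    · rw [hJ, indicator_of_mem hub]
      exact (le_abs_self _).trans (abs_pos_le h₁.sol.integrable hu.1.le)
    · rw [hJ, indicator_of_notMem hub]
      exact mul_nonneg hC₁0 hu.1.le
  set d : ℝ → ℝ := fun u => max (k₂ u - k₁ u) 0 with hd
  have hdm : Measurable d := (hk₂.sub hk₁).max measurable_const
  have hd0 : ∀ u, 0 ≤ d u := fun u => le_max_right _ _
  have hdJ : Integrable (fun u => d u * J u) m := by
    refine Integrable.mono' (g := fun u => C₁ / c * |g₂ u| + |g₁ u|)
      ((h₂.integrable.abs.const_mul _).add h₁.sol.integrable.abs)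
      (hdm.mul hJm).aestronglyMeasurable ?_
    filter_upwards [hm] with u hu
    rw [Real.norm_of_nonneg (mul_nonneg (hd0 u) (hJ0 u))]
    have hd' : d u ≤ |k₂ u| + |k₁ u| := max_le ((le_abs_self _).trans (abs_sub _ _)) (by positivity)
    have e1 : |k₂ u| * J u ≤ C₁ / c * |g₂ u| := by
      rw [h₂.eq u hu, abs_mul, abs_of_pos (h₂.pos_pos u hu)]
      have : J u ≤ C₁ / c * pos m g₂ u := by
        refine (hJC u hu).trans ?_
        calc C₁ * u = C₁ / c * (c * u) := by field_simp
          _ ≤ _ := by gcongr; exact hcle u hu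
      calc |k₂ u| * J u ≤ |k₂ u| * (C₁ / c * pos m g₂ u) := by gcongr
        _ = _ := by ring
    have e2 : |k₁ u| * J u ≤ |g₁ u| := by
      by_cases hub : u ∈ Ioc 0 b
      · rw [hJ, indicator_of_mem hub, h₁.sol.eq u hub, abs_mul,
          abs_of_nonneg (h₁.pos_nonneg u hub)]
      · rw [hJ, indicator_of_notMem hub, mul_zero]
        exact abs_nonneg _
    calc d u * J u ≤ (|k₂ u| + |k₁ u|) * J u := by gcongr; exact hJ0 u
      _ = |k₂ u| * J u + |k₁ u| * J u := by ring
      _ ≤ _ := add_le_add e1 e2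
  set f : ℝ → ℝ := fun u => d u * J u * |pos m g₂ u| with hf
  have hfm : Measurable f := (hdm.mul hJm).mul hc₂.measurable.abs
  have hf0 : ∀ u, 0 ≤ f u := fun u => mul_nonneg (mul_nonneg (hd0 u) (hJ0 u)) (abs_nonneg _)
  have hfu : Integrable (fun u => f u / u) m := by
    refine Integrable.mono' (hdJ.const_mul C₂) (hfm.div measurable_id).aestronglyMeasurable ?_
    filter_upwards [hm] with u hu
    rw [Real.norm_of_nonneg (div_nonneg (hf0 u) hu.1.le), div_le_iff₀ hu.1]
    have := abs_pos_le h₂.integrable hu.1.le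
    have h3 := mul_nonneg (hd0 u) (hJ0 u)
    calc f u ≤ d u * J u * (C₂ * u) := mul_le_mul_of_nonneg_left this h3
      _ = _ := by ring
  have hωi := integrableOn_div_sq hc₂ hc hcle hf0 hfm.aestronglyMeasurable hfu
  set ω : ℝ → ℝ := fun r => ∫ u in Ioc 0 r, f u ∂m with hω
  have hW : ∀ t ∈ Ioc 0 b, wronskian m g₁ g₂ t = -ω t := by
    intro t ht
    rw [h₁.sol.wronskian_eq h₂ hbs ht, hω, ← integral_neg]
    refine setIntegral_congr_ae measurableSet_Ioc ?_
    filter_upwards [hle] with u hu hut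
    have hub : u ∈ Ioc 0 b := ⟨hut.1, hut.2.trans ht.2⟩
    have hp := h₂.pos_pos u ⟨hub.1, hub.2.trans hbs⟩
    simp only [hf, hd, hJ]
    rw [indicator_of_mem hub, abs_of_pos hp, max_eq_left (sub_nonneg.2 hu)]
    ring
  have hintg : ∀ t ∈ Ioc 0 b, ∫ r in Ioc 0 t, ω r / pos m g₂ r ^ 2 =
      1 - pos m g₁ t / pos m g₂ t := by
    intro t ht
    have e : EqOn (fun r => -(ω r / pos m g₂ r ^ 2))
        (fun r => wronskian m g₁ g₂ r / pos m g₂ r ^ 2) (Ioc 0 t) := by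
      intro r hr
      simp only
      rw [hW r ⟨hr.1, hr.2.trans ht.2⟩, neg_div]
    have hts : t ≤ s := ht.2.trans hbs
    have h3 := setIntegral_wronskian_div h₁.sol.integrable h₂ ⟨ht.1, hts⟩
      ((hωi.mono_set (Ioc_subset_Ioc_right hts)).neg.congr_fun e measurableSet_Ioc)
    rw [← setIntegral_congr_fun measurableSet_Ioc e, integral_neg] at h3
    linarith
  set I := ∫ r in Ioc 0 s, ω r / pos m g₂ r ^ 2 with hI
  -- Damping with the full `f` already reaches zero at `b`, since the ratio vanishes there.
  have hI1 : 1 ≤ I := by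
    have h3 := hintg b ⟨h₁.mem.1, le_rfl⟩
    rw [h₁.pos_end_eq_zero hdead, zero_div, sub_zero] at h3
    rw [← h3]
    exact setIntegral_mono_set hωi
      (Eventually.of_forall fun r => div_nonneg (integral_nonneg fun u => hf0 u) (by positivity))
      (Ioc_subset_Ioc_right hbs).eventuallyLE
  -- Chosen so that the damping factor at time `s` is exactly `ε`; `a ≤ 1` keeps the coefficient
  -- above `k₁`.
  set a := (1 - ε) / I with ha
  have hI0 : 0 < I := by linarith
  have ha0 : 0 ≤ a := div_nonneg (by linarith [hε.2]) hI0.le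
  have ha1 : a ≤ 1 := by rw [ha, div_le_one hI0]; linarith [hε.1]
  have hdamp : ∀ t, damping m (pos m g₂) (fun u => a * f u) t =
      1 - a * ∫ r in Ioc 0 t, ω r / pos m g₂ r ^ 2 := by
    intro t
    rw [damping, ← integral_const_mul]
    congr 1
    refine integral_congr_ae (Eventually.of_forall fun r => ?_)
    simp only [hω]
    rw [integral_const_mul]
    ring
  have haf0 : ∀ u, 0 ≤ a * f u := fun u => mul_nonneg ha0 (hf0 u)
  have hafm : Measurable fun u => a * f u := hfm.const_mul a
  have hafu : Integrable (fun u => a * f u / u) m := by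
    simpa only [mul_div_assoc] using hfu.const_mul a
  have hds : damping m (pos m g₂) (fun u => a * f u) s = ε := by
    rw [hdamp, ← hI, ha, div_mul_cancel₀ _ hI0.ne']
    ring
  obtain ⟨h, hh, hhpos⟩ := h₂.exists_damped hs hm haf0 hafm.aestronglyMeasurable hafu
    (by rw [hds]; exact hε.1)
  have hDpos : ∀ u ∈ Ioc 0 s, 0 < damping m (pos m g₂) (fun u => a * f u) u := by
    intro u hu
    have := damping_antitoneOn hc₂ hc hcle haf0 hafm.aestronglyMeasurable hafu hu.2
      (mem_Iic.2 le_rfl) hu.2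
    rw [hds] at this
    exact hε.1.trans_le this
  refine ⟨_, h, ?_, hh, ?_, ?_, ?_⟩
  · exact hk₂.sub (hafm.div ((hc₂.measurable.pow_const 2).mul
      (measurable_damping hc₂.measurable hafm.aestronglyMeasurable)))
  · filter_upwards [hm, hle] with u hu hku
    have hp := h₂.pos_pos u hu
    have hD := hDpos u hu
    by_cases hub : u ∈ Ioc 0 b
    -- For `a = 1` this would be an equality; a smaller `a` only raises the right side. It bounds
    -- the amount subtracted from `k₂` by `a * (k₂ - k₁)`.
    · have h3 : J u ≤ pos m g₂ u * damping m (pos m g₂) (fun u => a * f u) u := by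
        rw [hdamp, hintg u hub, hJ, indicator_of_mem hub]
        have h4 : 0 ≤ 1 - pos m g₁ u / pos m g₂ u := by
          rw [← hintg u hub]
          exact integral_nonneg fun r => div_nonneg (integral_nonneg fun u => hf0 u) (by positivity)
        have h5 : pos m g₁ u = pos m g₂ u * (pos m g₁ u / pos m g₂ u) := by field_simp
        calc pos m g₁ u = pos m g₂ u * (pos m g₁ u / pos m g₂ u) := h5
          _ ≤ _ := by
            refine mul_le_mul_of_nonneg_left ?_ hp.le
            nlinarith
      have h6 : a * f u / (pos m g₂ u ^ 2 * damping m (pos m g₂) (fun u => a * f u) u) ≤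
          k₂ u - k₁ u := by
        rw [div_le_iff₀ (by positivity)]
        simp only [hf, hd]
        rw [abs_of_pos hp, max_eq_left (sub_nonneg.2 hku)]
        have h7 := sub_nonneg.2 hku
        calc a * ((k₂ u - k₁ u) * J u * pos m g₂ u)
            ≤ 1 * ((k₂ u - k₁ u) * J u * pos m g₂ u) :=
              mul_le_mul_of_nonneg_right ha1 (mul_nonneg (mul_nonneg h7 (hJ0 u)) hp.le)
          _ = (k₂ u - k₁ u) * pos m g₂ u * J u := by ring
          _ ≤ (k₂ u - k₁ u) * pos m g₂ u *
              (pos m g₂ u * damping m (pos m g₂) (fun u => a * f u) u) :=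
              mul_le_mul_of_nonneg_left h3 (mul_nonneg h7 hp.le)
          _ = _ := by ring
      linarith
    · have : f u = 0 := by simp only [hf, hJ]; rw [indicator_of_notMem hub]; ring
      rw [this, mul_zero, zero_div, sub_zero]
      exact hku
  · filter_upwards [hm] with u hu
    have hp := h₂.pos_pos u hu
    have hD := hDpos u hu
    exact sub_le_self _ (div_nonneg (haf0 u) (by positivity))
  · rw [hhpos s ⟨hs.le, le_rfl⟩, hds, mul_comm]

end Stopped

/-! ### Comparison when some member survives to time `s`. -/

section Families

variable {T : Type*}

/-- Composing with `arctan` makes the ranks bounded below, so an infimum exists; it is either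
attained, giving a constant sequence, or approached strictly from above. -/
lemma exists_seq_coinitial {S : Set T} (hS : S.Nonempty) (r : T → ℝ) :
    ∃ θ : ℕ → T, (∀ n, θ n ∈ S) ∧ Antitone (fun n => r (θ n)) ∧ ∀ τ ∈ S, ∃ n, r (θ n) ≤ r τ := by
  set R : T → ℝ := fun τ => Real.arctan (r τ) with hR
  have hRr : ∀ a b, R a ≤ R b ↔ r a ≤ r b := fun a b => Real.arctan_strictMono.le_iff_le
  have hne : (R '' S).Nonempty := hS.image R
  have hbdd : BddBelow (R '' S) :=
    ⟨-(Real.pi / 2), by rintro _ ⟨τ, _, rfl⟩; exact (Real.neg_pi_div_two_lt_arctan _).le⟩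
  have hglb := isGLB_csInf hne hbdd
  by_cases hc : sInf (R '' S) ∈ R '' S
  · obtain ⟨θ, hθ, hθe⟩ := hc
    refine ⟨fun _ => θ, fun _ => hθ, fun _ _ _ => le_rfl, fun τ hτ => ⟨0, (hRr _ _).1 ?_⟩⟩
    rw [hθe]
    exact hglb.1 ⟨τ, hτ, rfl⟩
  · obtain ⟨u, hanti, -, hlim, hu⟩ := hglb.exists_seq_strictAnti_tendsto_of_notMem hc hne
    choose θ hθ hθu using hu
    refine ⟨θ, hθ, fun a b hab => (hRr _ _).1 ?_, fun τ hτ => ?_⟩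
    · rw [hθu, hθu]
      exact hanti.antitone hab
    · have hlt : sInf (R '' S) < R τ :=
        lt_of_le_of_ne (hglb.1 ⟨τ, hτ, rfl⟩) fun h => hc (h ▸ ⟨τ, hτ, rfl⟩)
      obtain ⟨n, hn⟩ := (hlim.eventually (gt_mem_nhds hlt)).exists
      exact ⟨n, (hRr _ _).1 (by rw [hθu]; exact hn.le)⟩

lemma exists_seq_cofinal {S : Set T} (hS : S.Nonempty) (r : T → ℝ) :
    ∃ η : ℕ → T, (∀ n, η n ∈ S) ∧ Monotone (fun n => r (η n)) ∧ ∀ τ ∈ S, ∃ n, r τ ≤ r (η n) := by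
  obtain ⟨η, h1, h2, h3⟩ := exists_seq_coinitial hS fun τ => -r τ
  refine ⟨η, h1, fun a b hab => neg_le_neg_iff.1 (h2 hab), fun τ hτ => ?_⟩
  obtain ⟨n, hn⟩ := h3 τ hτ
  exact ⟨n, neg_le_neg_iff.1 hn⟩

variable [MeasurableSpace T]

/-- A measurable family of coefficients on `(0, s]` that is ordered by a real rank `r`, together
with measure-preserving shuffles. -/
structure RankedShuffle (μ : Measure T) (m : Measure ℝ) (s : ℝ) (r : T → ℝ) (k : T → ℝ → ℝ)
    (σ : ℝ → T → T) : Prop where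
  s_pos : 0 < s
  mem : ∀ᵐ u ∂m, u ∈ Ioc 0 s
  measurable_rank : Measurable r
  measurable_coeff : Measurable fun x : T × ℝ => k x.1 x.2
  coeff_le : ∀ τ τ', r τ ≤ r τ' → ∀ᵐ u ∂m, k τ u ≤ k τ' u
  measurable_shuffle : Measurable fun x : T × ℝ => σ x.2 x.1
  preserving : ∀ᵐ u ∂m, MeasurePreserving (σ u) μ μ

/-- `j` is a stopped solution of the Jacobi equation on `(0, s]`. -/
def IsStopped (m : Measure ℝ) (k : ℝ → ℝ) (s : ℝ) (j : ℝ → ℝ) : Prop :=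
  ∃ b g, StoppedAt m k s j b g

namespace RankedShuffle

variable {μ : Measure T} {m : Measure ℝ} {s : ℝ} {r : T → ℝ}
  {k : T → ℝ → ℝ} {σ : ℝ → T → T} {j₀ jσ : T → ℝ → ℝ}

lemma measurable_section (H : RankedShuffle μ m s r k σ) (τ : T) : Measurable (k τ) :=
  H.measurable_coeff.comp measurable_prodMk_left

lemma measurable_shuffled (H : RankedShuffle μ m s r k σ) :
    Measurable fun x : T × ℝ => k (σ x.2 x.1) x.2 :=
  H.measurable_coeff.comp (f := fun x : T × ℝ => (σ x.2 x.1, x.2))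
    (H.measurable_shuffle.prodMk measurable_snd)

lemma measurable_shuffled_section (H : RankedShuffle μ m s r k σ) (τ : T) :
    Measurable fun u => k (σ u τ) u :=
  H.measurable_shuffled.comp (measurable_prodMk_left (x := τ))

variable [IsProbabilityMeasure μ] [IsFiniteMeasure m]

/-- The exceptional times in `coeff_le` depend on the pair; Fubini exchanges them for exceptional
pairs at almost every time. -/
lemma ae_mono (H : RankedShuffle μ m s r k σ) :
    ∀ᵐ u ∂m, ∀ᵐ x ∂μ.prod μ, r x.2 ≤ r x.1 → k x.2 u ≤ k x.1 u := by
  have hr := H.measurable_rank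
  have h1 : Measurable fun z : (T × T) × ℝ => k z.1.2 z.2 :=
    H.measurable_coeff.comp (f := fun z : (T × T) × ℝ => (z.1.2, z.2)) (by fun_prop)
  have h2 : Measurable fun z : (T × T) × ℝ => k z.1.1 z.2 :=
    H.measurable_coeff.comp (f := fun z : (T × T) × ℝ => (z.1.1, z.2)) (by fun_prop)
  have h3 : Measurable fun z : (T × T) × ℝ => r z.1.2 := by fun_prop
  have h4 : Measurable fun z : (T × T) × ℝ => r z.1.1 := by fun_prop
  refine (Measure.ae_ae_comm (p := fun (x : T × T) u => r x.2 ≤ r x.1 → k x.2 u ≤ k x.1 u) ?_).1 ?_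
  · have := (measurableSet_le h3 h4).compl.union (measurableSet_le h1 h2)
    convert this using 1
    ext z
    simp only [mem_ofPred_eq, mem_union, mem_compl_iff]
    tauto
  · refine Eventually.of_forall fun x => ?_
    by_cases hx : r x.2 ≤ r x.1
    · filter_upwards [H.coeff_le _ _ hx] with u hu _ using hu
    · exact Eventually.of_forall fun u h => absurd h hx

/-- The comparison of the two total solutions relative to a positive solution `h` that lies below
a positive member `θ` of the family. -/
lemma tot_le_add (H : RankedShuffle μ m s r k σ)
    (h₀ : ∀ᵐ τ ∂μ, IsStopped m (k τ) s (j₀ τ))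
    (hσ : ∀ᵐ τ ∂μ, IsStopped m (fun u => k (σ u τ) u) s (jσ τ)) {γ h : ℝ → ℝ}
    (hγ : Measurable γ) (hh : IsLive m γ s h) {θ : T} (hθ : IsStopped m (k θ) s (j₀ θ))
    (hθs : 0 < j₀ θ s) (hγθ : ∀ᵐ u ∂m, γ u ≤ k θ u) {B : Set T} (hB : MeasurableSet B)
    (hBγ : ∀ τ ∈ B, ∀ᵐ u ∂m, k τ u ≤ γ u) {p : ℝ} (hp : 1 ≤ p) :
    Tot μ s p jσ ≤ Tot μ s p j₀ + ENNReal.ofReal (pos m h s ^ p) * μ B +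
      ENNReal.ofReal (j₀ θ s ^ p) * μ ({τ | r τ < r θ} \ B) := by
  have hs : s ∈ Ioc 0 s := ⟨H.s_pos, le_rfl⟩
  have hp0 : 0 ≤ p := by linarith
  have hhs := hh.pos_pos s hs
  have hE : MeasurableSet ({τ | r τ < r θ} \ B) :=
    (measurableSet_lt H.measurable_rank measurable_const).diff hB
  have scale : ∀ x : ℝ, 0 ≤ x → ENNReal.ofReal (pos m h s ^ p) *
      ENNReal.ofReal (x / pos m h s) ^ p = ENNReal.ofReal (x ^ p) := by
    intro x hx
    rw [ENNReal.ofReal_rpow_of_nonneg (by positivity) hp0, ← ENNReal.ofReal_mul (by positivity),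
      ← Real.mul_rpow hhs.le (by positivity), mul_div_cancel₀ _ hhs.ne']
  obtain ⟨bθ, gθ, hgθ⟩ := hθ
  have hθl := hgθ.isLive hθs
  have hθe : j₀ θ s = pos m gθ s := hgθ.eq s ⟨H.s_pos, (hgθ.eq_end hθs).ge⟩
  have hK := measurable_kernel (continuous_pos hh.integrable)
  have hq : Measurable fun x : T × ℝ => k x.1 x.2 - γ x.2 :=
    H.measurable_coeff.sub (hγ.comp measurable_snd)
  calc Tot μ s p jσ
      ≤ ∫⁻ τ, ENNReal.ofReal (pos m h s ^ p) *
        (∑' n, neumann m (kernel (pos m h)) (fun u => k (σ u τ) u - γ u) n s) ^ p ∂μ := by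
        refine lintegral_mono_ae ?_
        filter_upwards [hσ] with τ hτ
        obtain ⟨b, g, hg⟩ := hτ
        rw [← scale _ (hg.nonneg hs)]
        gcongr
        exact hg.le_tsum H.mem H.s_pos (H.measurable_shuffled_section τ) hγ hh
    _ = ENNReal.ofReal (pos m h s ^ p) * ∫⁻ τ,
        (∑' n, neumann m (kernel (pos m h)) (fun u => k (σ u τ) u - γ u) n s) ^ p ∂μ :=
        lintegral_const_mul' _ _ ENNReal.ofReal_ne_top
    _ ≤ ENNReal.ofReal (pos m h s ^ p) * ∫⁻ τ,
        (∑' n, neumann m (kernel (pos m h)) (fun u => k τ u - γ u) n s) ^ p ∂μ := by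
        refine mul_le_mul_right (lintegral_neumann_rpow_le (r := r)
          (q := fun τ u => k τ u - γ u) hK H.measurable_rank hq ?_
          H.measurable_shuffle H.preserving s hp) _
        filter_upwards [H.ae_mono] with u hu
        filter_upwards [hu] with x hx hr
        exact sub_le_sub_right (hx hr) _
    _ = ∫⁻ τ, ENNReal.ofReal (pos m h s ^ p) *
        (∑' n, neumann m (kernel (pos m h)) (fun u => k τ u - γ u) n s) ^ p ∂μ :=
        (lintegral_const_mul' _ _ ENNReal.ofReal_ne_top).symm
    _ ≤ ∫⁻ τ, (ENNReal.ofReal (j₀ τ s ^ p) +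
        B.indicator (fun _ => ENNReal.ofReal (pos m h s ^ p)) τ +
        ({τ | r τ < r θ} \ B).indicator (fun _ => ENNReal.ofReal (j₀ θ s ^ p)) τ) ∂μ := by
        refine lintegral_mono_ae ?_
        filter_upwards [h₀] with τ hτ
        -- Three ranges: on `B` the coefficient is below `γ` and the series is `1`; between `B` and
        -- `θ` the series is at most the ratio for `θ`; from `θ` upwards the solution is live and
        -- the series is at most its own ratio.
        by_cases hτB : τ ∈ B
        · rw [tsum_neumann_eq_one, ENNReal.one_rpow, mul_one, indicator_of_mem hτB]
          · exact le_trans le_add_self le_self_add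
          · filter_upwards [hBγ τ hτB] with u hu using sub_nonpos.2 hu
        rcases lt_or_ge (r τ) (r θ) with hr | hr
        · have : τ ∈ {τ | r τ < r θ} \ B := ⟨hr, hτB⟩
          rw [indicator_of_mem this]
          refine le_trans ?_ le_add_self
          rw [← scale _ hθs.le, hθe]
          gcongr
          exact hθl.tsum_le H.mem H.s_pos (H.measurable_section θ) (H.measurable_section τ) hγ hh
            hγθ (H.coeff_le _ _ hr.le)
        · obtain ⟨b, g, hg⟩ := hτ
          have hle : ∀ᵐ u ∂m, k θ u ≤ k τ u := H.coeff_le _ _ hr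
          have hlive := hg.lt_of_isLive H.mem (H.measurable_section τ) (H.measurable_section θ)
            hθl hle
          refine le_trans ?_ (le_trans le_self_add le_self_add)
          rw [← scale _ hlive.le, hg.eq s ⟨H.s_pos, (hg.eq_end hlive).ge⟩]
          gcongr
          refine (hg.isLive hlive).tsum_le H.mem H.s_pos (H.measurable_section τ)
            (H.measurable_section τ) hγ hh ?_ (Eventually.of_forall fun u => le_rfl)
          filter_upwards [hle, hγθ] with u h1 h2 using h2.trans h1
    _ = _ := by
        rw [lintegral_add_right _ (measurable_const.indicator hE),
          lintegral_add_right _ (measurable_const.indicator hB), lintegral_indicator_const hB,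
          lintegral_indicator_const hE]
        rfl

/-- The comparison, when some member of the family has a solution that is positive up to `s`. -/
lemma tot_le_of_live (H : RankedShuffle μ m s r k σ)
    (h₀ : ∀ᵐ τ ∂μ, IsStopped m (k τ) s (j₀ τ))
    (hσ : ∀ᵐ τ ∂μ, IsStopped m (fun u => k (σ u τ) u) s (jσ τ))
    (hlive : ∃ θ, IsStopped m (k θ) s (j₀ θ) ∧ 0 < j₀ θ s) {p : ℝ} (hp : 1 ≤ p) :
    Tot μ s p jσ ≤ Tot μ s p j₀ := by
  have hs : s ∈ Ioc 0 s := ⟨H.s_pos, le_rfl⟩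
  have hp0 : 0 < p := by linarith
  obtain ⟨θ, hθ, hθanti, hθco⟩ :=
    exists_seq_coinitial (S := {θ | IsStopped m (k θ) s (j₀ θ) ∧ 0 < j₀ θ s}) hlive r
  set M := j₀ (θ 0) s with hM
  have hM0 : 0 < M := (hθ 0).2
  have hθM : ∀ n, j₀ (θ n) s ≤ M := by
    intro n
    obtain ⟨⟨b, g, hg⟩, hl⟩ := hθ n
    obtain ⟨⟨b', g', hg'⟩, hl'⟩ := hθ 0
    have hL := hg.isLive hl
    have hL' := hg'.isLive hl'
    rw [hM, hg.eq s ⟨H.s_pos, (hg.eq_end hl).ge⟩, hg'.eq s ⟨H.s_pos, (hg'.eq_end hl').ge⟩]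
    refine hL'.pos_le_pos (H.mem.mono fun u hu => hu.1) (H.measurable_section _)
      (H.measurable_section _) hL le_rfl (fun u hu => (hL'.pos_pos u hu).le) ?_ hs
    filter_upwards [H.coeff_le _ _ (hθanti (Nat.zero_le n))] with u hu _ using hu
  -- The sets `B n` exhaust the dead members from below, and the base lies between `B n` and the
  -- live member `θ n`. If nobody is dead, `B n` is empty and `θ n` itself serves as base.
  obtain ⟨B, hBm, hBmono, hBdead, hbase⟩ : ∃ B : ℕ → Set T, (∀ n, MeasurableSet (B n)) ∧
      Monotone B ∧ (∀ τ, IsStopped m (k τ) s (j₀ τ) → j₀ τ s = 0 → ∃ n, τ ∈ B n) ∧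
      ∀ n, ∀ ε ∈ Ioo (0 : ℝ) 1, ∃ γ h, Measurable γ ∧ IsLive m γ s h ∧
        (∀ᵐ u ∂m, γ u ≤ k (θ n) u) ∧ (∀ τ ∈ B n, ∀ᵐ u ∂m, k τ u ≤ γ u) ∧
        ENNReal.ofReal (pos m h s ^ p) * μ (B n) ≤ ENNReal.ofReal ((ε * M) ^ p) := by
    by_cases hD : ∃ η, IsStopped m (k η) s (j₀ η) ∧ j₀ η s = 0
    · obtain ⟨η, hη, hηmono, hηco⟩ :=
        exists_seq_cofinal (S := {η | IsStopped m (k η) s (j₀ η) ∧ j₀ η s = 0}) hD r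
      refine ⟨fun n => {τ | r τ ≤ r (η n)},
        fun n => measurableSet_le H.measurable_rank measurable_const,
        fun a b hab τ (hτ : r τ ≤ r (η a)) => le_trans hτ (hηmono hab),
        fun τ h1 h2 => hηco τ ⟨h1, h2⟩, fun n ε hε => ?_⟩
      obtain ⟨⟨b, g, hg⟩, hl⟩ := hθ n
      obtain ⟨⟨b', g', hg'⟩, hd⟩ := hη n
      have hL := hg.isLive hl
      have hr : r (η n) ≤ r (θ n) := by
        by_contra hlt
        exact hd.not_gt (hg'.lt_of_isLive H.mem (H.measurable_section _) (H.measurable_section _) hL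
          (H.coeff_le _ _ (not_le.1 hlt).le))
      obtain ⟨γ, h, hγ, hh, h1, h2, h3⟩ := hg'.exists_between H.mem (H.measurable_section _)
        (H.measurable_section _) hd hL (H.coeff_le _ _ hr) hε
      refine ⟨γ, h, hγ, hh, h2, fun τ hτ => ?_, ?_⟩
      · filter_upwards [H.coeff_le _ _ hτ, h1] with u h4 h5 using h4.trans h5
      · refine (mul_le_of_le_one_right zero_le prob_le_one).trans (ENNReal.ofReal_le_ofReal ?_)
        refine Real.rpow_le_rpow (hh.pos_pos s hs).le ?_ hp0.le
        rw [h3, ← hg.eq s ⟨H.s_pos, (hg.eq_end hl).ge⟩]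
        exact mul_le_mul_of_nonneg_left (hθM n) hε.1.le
    · refine ⟨fun _ => ∅, fun _ => MeasurableSet.empty, fun _ _ _ => le_rfl,
        fun τ h1 h2 => absurd ⟨τ, h1, h2⟩ hD, fun n ε hε => ?_⟩
      obtain ⟨⟨b, g, hg⟩, hl⟩ := hθ n
      exact ⟨k (θ n), g, H.measurable_section _, hg.isLive hl,
        Eventually.of_forall fun u => le_rfl, by simp, by simp⟩
  set E : ℕ → Set T := fun n => {τ | r τ < r (θ n)} \ B n with hE
  have hElim : Tendsto (fun n => μ (E n)) atTop (𝓝 0) := by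
    have hEm : ∀ n, MeasurableSet (E n) := fun n =>
      (measurableSet_lt H.measurable_rank measurable_const).diff (hBm n)
    have ht := tendsto_measure_iInter_atTop (μ := μ) (s := E)
      (fun n => (hEm n).nullMeasurableSet)
      (fun a b hab τ hτ => ⟨lt_of_lt_of_le hτ.1 (hθanti hab), fun h => hτ.2 (hBmono hab h)⟩)
      ⟨0, measure_ne_top _ _⟩
    -- Almost every member is dead or live, hence eventually in `B n` or of rank at least that of
    -- some `θ n`.
    have h0 : μ (⋂ n, E n) = 0 := by
      rw [measure_eq_zero_iff_ae_notMem]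
      filter_upwards [h₀] with τ hτ hmem
      rw [mem_iInter] at hmem
      obtain ⟨b, g, hg⟩ := id hτ
      rcases (hg.nonneg hs).eq_or_lt with hz | hz
      · obtain ⟨n, hn⟩ := hBdead τ hτ hz.symm
        exact (hmem n).2 hn
      · obtain ⟨n, hn⟩ := hθco τ ⟨hτ, hz⟩
        exact absurd (hmem n).1 (not_lt.2 hn)
    rwa [h0] at ht
  have hbound : ∀ n : ℕ, Tot μ s p jσ ≤ Tot μ s p j₀ +
      ENNReal.ofReal ((1 / ((n : ℝ) + 2) * M) ^ p) + ENNReal.ofReal (M ^ p) * μ (E n) := by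
    intro n
    have hε : 1 / ((n : ℝ) + 2) ∈ Ioo (0 : ℝ) 1 := by
      refine ⟨by positivity, ?_⟩
      rw [div_lt_one (by positivity)]
      linarith [(Nat.cast_nonneg n : (0 : ℝ) ≤ n)]
    obtain ⟨γ, h, hγ, hh, h1, h2, h3⟩ := hbase n _ hε
    refine (H.tot_le_add h₀ hσ hγ hh (hθ n).1 (hθ n).2 h1 (hBm n) h2 hp).trans ?_
    gcongr
    · exact (hθ n).2.le
    · exact hθM n
  have hlim1 : Tendsto (fun n : ℕ => ENNReal.ofReal ((1 / ((n : ℝ) + 2) * M) ^ p)) atTop (𝓝 0) := by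
    have h1 : Tendsto (fun n : ℕ => 1 / ((n : ℝ) + 2) * M) atTop (𝓝 (0 * M)) :=
      (tendsto_const_nhds.div_atTop
        (tendsto_atTop_add_const_right _ _ tendsto_natCast_atTop_atTop)).mul_const M
    have h2 := ENNReal.tendsto_ofReal (h1.rpow_const (Or.inr hp0.le))
    rwa [zero_mul, Real.zero_rpow hp0.ne', ENNReal.ofReal_zero] at h2
  have hlim2 : Tendsto (fun n => ENNReal.ofReal (M ^ p) * μ (E n)) atTop (𝓝 0) := by
    simpa using ENNReal.Tendsto.const_mul hElim (Or.inr (ENNReal.ofReal_ne_top (r := M ^ p)))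
  have hlim := (tendsto_const_nhds (x := Tot μ s p j₀)).add hlim1 |>.add hlim2
  rw [add_zero, add_zero] at hlim
  exact ge_of_tendsto' hlim hbound

end RankedShuffle

end Families

/-! ### The case in which no member survives, and the main theorem. -/

section Dead

variable {T : Type*} [MeasurableSpace T]

/-- Survival has a cost: as `|k| * pos m g = |g|` is integrable and the position is at least `c u`,
the function `u * |k u|` is integrable. -/
lemma IsLive.exists_mul_abs_le {m : Measure ℝ} [SFinite m] {k g : ℝ → ℝ} {s : ℝ} (hs : 0 < s)
    (hg : IsLive m k s g) : ∃ c > 0, ∀ u ∈ Ioc 0 s, c * u ≤ pos m g u ∧ u * |k u| ≤ 1 / c * |g u| := by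
  obtain ⟨c, hc, hle⟩ := exists_mul_le_pos hg.integrable hs hg.pos_pos
  refine ⟨c, hc, fun u hu => ⟨hle u hu, ?_⟩⟩
  rw [hg.eq u hu, abs_mul, abs_of_pos (hg.pos_pos u hu), one_div, ← div_eq_inv_mul,
    le_div_iff₀ hc]
  calc u * |k u| * c = |k u| * (c * u) := by ring
    _ ≤ _ := by gcongr; exact hle u hu

/-- If a positive solution is given, and the coefficients `κ n` increase past its coefficient
almost everywhere, then the solutions for `κ n` cannot all die by time `s`, unless the negative
parts of `κ n` are not integrable. -/
lemma IsLive.exists_lt_of_eventually_le {m : Measure ℝ} [IsFiniteMeasure m] {k g : ℝ → ℝ} {s : ℝ}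
    (hs : 0 < s) (hm : ∀ᵐ u ∂m, u ∈ Ioc 0 s) (hk : Measurable k) (hg : IsLive m k s g)
    {κ : ℕ → ℝ → ℝ} (hκ : ∀ n, Measurable (κ n)) (hmono : ∀ᵐ u ∂m, Monotone fun n => κ n u)
    (hcof : ∀ᵐ u ∂m, ∃ n, k u ≤ κ n u) (hintg : Integrable (fun u => u * max (-κ 0 u) 0) m)
    {j : ℕ → ℝ → ℝ} (hj : ∀ n, IsStopped m (κ n) s (j n)) : ∃ n, 0 < j n s := by
  obtain ⟨c, hc, hle⟩ := hg.exists_mul_abs_le hs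
  have hcont := continuous_pos hg.integrable
  set C := 1 + ∫ u, |g u| ∂m with hC
  set q : ℕ → ℝ → ℝ := fun n u => max (k u - κ n u) 0 with hq
  have hq0 : ∀ n u, 0 ≤ q n u := fun n u => le_max_right _ _
  have hqm : ∀ n, Measurable (q n) := fun n => (hk.sub (hκ n)).max measurable_const
  -- Damping with this `f` lowers `k` by `q n` divided by a factor at most `1`, hence by at least `q
  -- n`, which brings it below `κ n`.
  set f : ℕ → ℝ → ℝ := fun n u => q n u * pos m g u ^ 2 with hf
  have hf0 : ∀ n u, 0 ≤ f n u := fun n u => mul_nonneg (hq0 n u) (sq_nonneg _)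
  have hfm : ∀ n, Measurable (f n) := fun n => (hqm n).mul (hcont.measurable.pow_const 2)
  set bd : ℝ → ℝ := fun u => C ^ 2 * (1 / c * |g u| + u * max (-κ 0 u) 0) with hbd
  have hbdi : Integrable bd m := ((hg.integrable.abs.const_mul _).add hintg).const_mul _
  -- As the `κ n` increase, the negative part of `κ 0` controls the others, so one function
  -- dominates all `n`. Pointwise `f n` is eventually zero, and for large `n` the damping factor
  -- stays positive.
  have hfle : ∀ n, ∀ᵐ u ∂m, ‖f n u / u‖ ≤ bd u := by
    intro n
    filter_upwards [hm, hmono] with u hu hmu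
    have hu0 := hu.1
    rw [Real.norm_of_nonneg (div_nonneg (hf0 n u) hu.1.le), div_le_iff₀ hu.1]
    have h1 := abs_pos_le hg.integrable hu.1.le
    have h2 : pos m g u ^ 2 ≤ (C * u) ^ 2 := sq_le_sq' (by linarith [neg_abs_le (pos m g u)])
      ((le_abs_self _).trans h1)
    have h3 : q n u ≤ |k u| + max (-κ 0 u) 0 := by
      refine max_le ?_ (by positivity)
      have h4 : κ 0 u ≤ κ n u := hmu (Nat.zero_le n)
      linarith [le_abs_self (k u), le_max_left (-κ 0 u) 0]
    have h5 := (hle u hu).2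
    calc f n u ≤ (|k u| + max (-κ 0 u) 0) * (C * u) ^ 2 :=
          mul_le_mul h3 h2 (sq_nonneg _) (by positivity)
      _ = C ^ 2 * (u * |k u| + u * max (-κ 0 u) 0) * u := by ring
      _ ≤ _ := by
        simp only [hbd]
        gcongr
  have hfi : ∀ n, Integrable (fun u => f n u / u) m := fun n =>
    hbdi.mono' ((hfm n).div measurable_id).aestronglyMeasurable (hfle n)
  have hlim : Tendsto (fun n => ∫ u, f n u / u ∂m) atTop (𝓝 (∫ _, (0 : ℝ) ∂m)) := by
    refine tendsto_integral_of_dominated_convergence bd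
      (fun n => ((hfm n).div measurable_id).aestronglyMeasurable) hbdi hfle ?_
    filter_upwards [hmono, hcof] with u hmu hcu
    obtain ⟨n₀, hn₀⟩ := hcu
    refine tendsto_const_nhds.congr' ?_
    filter_upwards [eventually_ge_atTop n₀] with n hn
    have h1 : k u ≤ κ n u := hn₀.trans (hmu hn)
    simp only [hf, hq]
    rw [max_eq_right (sub_nonpos.2 h1)]
    simp
  rw [integral_zero] at hlim
  have hlim' := hlim.const_mul (1 / c ^ 2)
  rw [mul_zero] at hlim'
  obtain ⟨n, hn⟩ := (hlim'.eventually (gt_mem_nhds zero_lt_one)).exists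
  have hle1 : ∀ t ∈ Ioc 0 s, c * t ≤ pos m g t := fun t ht => (hle t ht).1
  have hanti := damping_antitoneOn hcont hc hle1 (hf0 n) (hfm n).aestronglyMeasurable (hfi n)
  have hZ : 0 < damping m (pos m g) (f n) s := by
    have := one_sub_damping_le hcont hc hle1 (hf0 n) (hfm n).aestronglyMeasurable (hfi n) hm
      (le_refl s)
    linarith
  obtain ⟨g', hg', -⟩ := hg.exists_damped hs hm (hf0 n) (hfm n).aestronglyMeasurable (hfi n) hZ
  obtain ⟨b, gj, hgj⟩ := hj n
  refine ⟨n, hgj.lt_of_isLive hm (hκ n) ?_ hg' ?_⟩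
  · exact hk.sub ((hfm n).div ((hcont.measurable.pow_const 2).mul
      (measurable_damping hcont.measurable (hfm n).aestronglyMeasurable)))
  · filter_upwards [hm] with u hu
    have hp := hg.pos_pos u hu
    have hD0 : 0 < damping m (pos m g) (f n) u := hZ.trans_le (hanti hu.2 (mem_Iic.2 le_rfl) hu.2)
    have hD1 : damping m (pos m g) (f n) u ≤ 1 := by
      have := hanti (mem_Iic.2 hs.le) (mem_Iic.2 hu.2) hu.1.le
      rwa [damping_zero] at this
    have h1 : q n u ≤ f n u / (pos m g u ^ 2 * damping m (pos m g) (f n) u) := by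
      rw [le_div_iff₀ (by positivity)]
      calc q n u * (pos m g u ^ 2 * damping m (pos m g) (f n) u)
          = q n u * pos m g u ^ 2 * damping m (pos m g) (f n) u := by ring
        _ ≤ q n u * pos m g u ^ 2 * 1 :=
          mul_le_mul_of_nonneg_left hD1 (mul_nonneg (hq0 n u) (sq_nonneg _))
        _ = f n u := mul_one _
    have h2 : k u - κ n u ≤ q n u := le_max_left _ _
    linarith

namespace RankedShuffle

variable {μ : Measure T} [IsProbabilityMeasure μ] {m : Measure ℝ} [IsFiniteMeasure m] {s : ℝ}
  {r : T → ℝ} {k : T → ℝ → ℝ} {σ : ℝ → T → T} {j₀ jσ : T → ℝ → ℝ}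

/-- If the shuffled coefficients have integrable negative parts with positive probability, then so
does any member of the family that is close enough to the top. -/
lemma lintegral_neg_ne_top (H : RankedShuffle μ m s r k σ) {A : Set T} (hA : MeasurableSet A)
    {N : ℝ≥0∞} (hN : N ≠ ∞)
    (hAN : ∀ τ ∈ A, ∫⁻ u, ENNReal.ofReal u * ENNReal.ofReal (-k (σ u τ) u) ∂m ≤ N) {η : T}
    (hη : μ {τ | r η < r τ} < μ A) :
    ∫⁻ u, ENNReal.ofReal u * ENNReal.ofReal (-k η u) ∂m ≠ ∞ := by
  set δ := μ {τ | r η < r τ} with hδ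
  set φ : ℝ → ℝ≥0∞ := fun u => ENNReal.ofReal u * ENNReal.ofReal (-k η u) with hφ
  have hφm : Measurable φ := (ENNReal.measurable_ofReal).mul (H.measurable_section η).neg.ennreal_ofReal
  have hkσ := H.measurable_shuffled
  have hmeas : Measurable fun x : T × ℝ => ENNReal.ofReal x.2 * ENNReal.ofReal (-k (σ x.2 x.1) x.2) :=
    measurable_snd.ennreal_ofReal.mul hkσ.neg.ennreal_ofReal
  -- At almost every time, measure preservation leaves a part of `A` of mass at least `μ A - δ` on
  -- which the shuffled coefficient is at most `k η u`. Integrating the negative parts over `A` then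
  -- bounds that of `k η`.
  have hsmall : ∀ᵐ u ∂m, μ {τ | k η u < k τ u} ≤ δ := by
    have hset : MeasurableSet {x : T × ℝ | r x.1 ≤ r η → k x.1 x.2 ≤ k η x.2} := by
      have h1 : Measurable fun x : T × ℝ => r x.1 := H.measurable_rank.comp measurable_fst
      have h2 : Measurable fun x : T × ℝ => k η x.2 := (H.measurable_section η).comp measurable_snd
      have := (measurableSet_le h1 (measurable_const (a := r η))).compl.union
        (measurableSet_le H.measurable_coeff h2)
      convert this using 1
      ext z
      simp only [mem_ofPred_eq, mem_union, mem_compl_iff]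
      tauto
    have hae : ∀ᵐ τ ∂μ, ∀ᵐ u ∂m, r τ ≤ r η → k τ u ≤ k η u := by
      refine Eventually.of_forall fun τ => ?_
      by_cases hτ : r τ ≤ r η
      · filter_upwards [H.coeff_le _ _ hτ] with u hu _ using hu
      · exact Eventually.of_forall fun u h => absurd h hτ
    have hae' := (Measure.ae_ae_comm (p := fun τ u => r τ ≤ r η → k τ u ≤ k η u) hset).1 hae
    filter_upwards [hae'] with u hu
    refine measure_mono_ae ?_
    filter_upwards [hu] with τ hτ (hlt : k η u < k τ u)
    show r η < r τ
    by_contra hle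
    exact absurd (hτ (not_lt.1 hle)) (not_le.2 hlt)
  have hlow : (μ A - δ) * ∫⁻ u, φ u ∂m ≤ N := by
    calc (μ A - δ) * ∫⁻ u, φ u ∂m = ∫⁻ u, (μ A - δ) * φ u ∂m :=
          (lintegral_const_mul _ hφm).symm
      _ ≤ ∫⁻ u, ∫⁻ τ in A, ENNReal.ofReal u * ENNReal.ofReal (-k (σ u τ) u) ∂μ ∂m := by
          refine lintegral_mono_ae ?_
          filter_upwards [hsmall, H.preserving] with u hu hpu
          set V : Set T := {τ | k η u < k τ u}
          have hV : MeasurableSet V := measurableSet_lt measurable_const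
            (H.measurable_coeff.comp measurable_prodMk_right)
          have hV' : MeasurableSet (σ u ⁻¹' V) := hpu.measurable hV
          have h1 : μ A - δ ≤ μ (A \ σ u ⁻¹' V) := by
            refine le_trans ?_ (le_measure_sdiff (s₁ := A) (s₂ := σ u ⁻¹' V))
            rw [hpu.measure_preimage hV.nullMeasurableSet]
            exact tsub_le_tsub_left hu _
          calc (μ A - δ) * φ u ≤ μ (A \ σ u ⁻¹' V) * φ u := by gcongr
            _ = ∫⁻ _ in A \ σ u ⁻¹' V, φ u ∂μ := by rw [setLIntegral_const, mul_comm]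
            _ ≤ ∫⁻ τ in A \ σ u ⁻¹' V, ENNReal.ofReal u * ENNReal.ofReal (-k (σ u τ) u) ∂μ := by
                refine setLIntegral_mono' (hA.diff hV') fun τ hτ => ?_
                have : k (σ u τ) u ≤ k η u := not_lt.1 hτ.2
                simp only [hφ]
                gcongr
            _ ≤ _ := lintegral_mono_set sdiff_subset
      _ = ∫⁻ τ in A, ∫⁻ u, ENNReal.ofReal u * ENNReal.ofReal (-k (σ u τ) u) ∂m ∂μ := by
          rw [lintegral_lintegral_swap]
          exact hmeas.aemeasurable.prod_swap
      _ ≤ ∫⁻ _ in A, N ∂μ := setLIntegral_mono' hA hAN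
      _ = N * μ A := setLIntegral_const _ _
      _ ≤ N := mul_le_of_le_one_right zero_le prob_le_one
  intro htop
  rw [htop, ENNReal.mul_top (tsub_pos_of_lt hη).ne'] at hlow
  exact hN (top_le_iff.1 hlow)

/-- If all solutions of the family have died by time `s`, then so have the shuffled solutions. -/
lemma ae_eq_zero_of_dead (H : RankedShuffle μ m s r k σ)
    (h₀ : ∀ᵐ τ ∂μ, IsStopped m (k τ) s (j₀ τ))
    (hσ : ∀ᵐ τ ∂μ, IsStopped m (fun u => k (σ u τ) u) s (jσ τ))
    (hdead : ∀ τ, IsStopped m (k τ) s (j₀ τ) → ¬ 0 < j₀ τ s) : ∀ᵐ τ ∂μ, jσ τ s = 0 := by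
  have hs : s ∈ Ioc 0 s := ⟨H.s_pos, le_rfl⟩
  by_contra hne
  set J : T → ℝ≥0∞ := fun τ => ∫⁻ u, ENNReal.ofReal u * ENNReal.ofReal (-k (σ u τ) u) ∂m with hJ
  have hJm : Measurable J := by
    refine Measurable.lintegral_prod_right' (f := fun x : T × ℝ =>
      ENNReal.ofReal x.2 * ENNReal.ofReal (-k (σ x.2 x.1) x.2)) ?_
    exact measurable_snd.ennreal_ofReal.mul H.measurable_shuffled.neg.ennreal_ofReal
  have hJfin : ∀ᵐ τ ∂μ, 0 < jσ τ s → J τ ≠ ∞ := by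
    filter_upwards [hσ] with τ hτ hpos
    obtain ⟨b, g, hg⟩ := hτ
    obtain ⟨c, hc, hle⟩ := (hg.isLive hpos).exists_mul_abs_le H.s_pos
    have hfin : ∫⁻ u, ENNReal.ofReal (1 / c * |g u|) ∂m ≠ ∞ :=
      (Integrable.lintegral_lt_top (hg.sol.integrable.abs.const_mul (1 / c))).ne
    refine ne_top_of_le_ne_top hfin (lintegral_mono_ae ?_)
    filter_upwards [H.mem] with u hu
    rw [← ENNReal.ofReal_mul hu.1.le]
    refine ENNReal.ofReal_le_ofReal (le_trans ?_ (hle u hu).2)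
    exact mul_le_mul_of_nonneg_left (neg_le_abs _) hu.1.le
  -- Surviving shuffled solutions have `J` finite, so survival with positive probability gives a
  -- uniform bound on a set of positive measure. Some `η n₁` then has less than that mass ranked
  -- above it.
  obtain ⟨N, hN⟩ : ∃ N : ℕ, 0 < μ {τ | J τ ≤ N} := by
    by_contra hall
    push Not at hall
    apply hne
    have hnull : ∀ᵐ τ ∂μ, ∀ N : ℕ, ¬ J τ ≤ N := by
      rw [ae_all_iff]
      intro N
      exact measure_eq_zero_iff_ae_notMem.1 (nonpos_iff_eq_zero.1 (hall N))
    filter_upwards [hnull, hJfin, hσ] with τ h1 h2 h3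
    obtain ⟨b, g, hg⟩ := h3
    by_contra hnz
    obtain ⟨N, hN⟩ := ENNReal.exists_nat_gt (h2 (lt_of_le_of_ne (hg.nonneg hs) (Ne.symm hnz)))
    exact h1 N hN.le
  obtain ⟨τ₀, hτ₀⟩ := h₀.exists
  obtain ⟨η, hη, hηmono, hηco⟩ :=
    exists_seq_cofinal (S := {τ | IsStopped m (k τ) s (j₀ τ)}) ⟨τ₀, hτ₀⟩ r
  obtain ⟨n₁, hn₁⟩ : ∃ n, μ {τ | r (η n) < r τ} < μ {τ | J τ ≤ N} := by
    have ht := tendsto_measure_iInter_atTop (μ := μ) (s := fun n => {τ | r (η n) < r τ})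
      (fun n => (measurableSet_lt measurable_const H.measurable_rank).nullMeasurableSet)
      (fun a b hab τ (hτ : r (η b) < r τ) => lt_of_le_of_lt (hηmono hab) hτ)
      ⟨0, measure_ne_top _ _⟩
    have h0 : μ (⋂ n, {τ | r (η n) < r τ}) = 0 := by
      rw [measure_eq_zero_iff_ae_notMem]
      filter_upwards [h₀] with τ hτ hmem
      rw [mem_iInter] at hmem
      obtain ⟨n, hn⟩ := hηco τ hτ
      exact absurd (hmem n) (not_lt.2 hn)
    rw [h0] at ht
    exact (ht.eventually (gt_mem_nhds hN)).exists
  have hfin := H.lintegral_neg_ne_top (measurableSet_le hJm measurable_const)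
    (ENNReal.natCast_ne_top N) (fun τ hτ => hτ) hn₁
  have hmonoκ : ∀ᵐ u ∂m, Monotone fun n => k (η (n + n₁)) u := by
    have : ∀ᵐ u ∂m, ∀ a b : ℕ, a ≤ b → k (η (a + n₁)) u ≤ k (η (b + n₁)) u := by
      rw [ae_all_iff]
      intro a
      rw [ae_all_iff]
      intro b
      by_cases hab : a ≤ b
      · filter_upwards [H.coeff_le _ _ (hηmono (Nat.add_le_add_right hab n₁))] with u hu _ using hu
      · exact Eventually.of_forall fun u h => absurd h hab
    exact this
  have hintg : Integrable (fun u => u * max (-k (η (0 + n₁)) u) 0) m := by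
    rw [zero_add]
    have hmk := H.measurable_section (η n₁)
    refine ⟨(measurable_id.mul (hmk.neg.max measurable_const)).aestronglyMeasurable, ?_⟩
    rw [hasFiniteIntegral_iff_enorm]
    refine lt_of_le_of_lt (lintegral_mono_ae ?_) (lt_top_iff_ne_top.2 hfin)
    filter_upwards [H.mem] with u hu
    rw [Real.enorm_eq_ofReal (mul_nonneg hu.1.le (le_max_right _ _)), ENNReal.ofReal_mul hu.1.le]
    simp
  -- The cofinality of `η` holds for almost every member at almost every time, and transfers to the
  -- shuffled family because each `σ u` pulls null sets back to null sets.
  have hcof : ∀ᵐ τ ∂μ, ∀ᵐ u ∂m, ∃ n, k (σ u τ) u ≤ k (η (n + n₁)) u := by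
    have hmk : ∀ n, Measurable fun x : T × ℝ => k (η (n + n₁)) x.2 := fun n =>
      (H.measurable_section _).comp measurable_snd
    have hset : MeasurableSet {x : T × ℝ | ∃ n, k x.1 x.2 ≤ k (η (n + n₁)) x.2} := by
      rw [ofPred_exists]
      exact MeasurableSet.iUnion fun n => measurableSet_le H.measurable_coeff (hmk n)
    have hset' : MeasurableSet {x : T × ℝ | ∃ n, k (σ x.2 x.1) x.2 ≤ k (η (n + n₁)) x.2} := by
      rw [ofPred_exists]
      exact MeasurableSet.iUnion fun n => measurableSet_le H.measurable_shuffled (hmk n)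
    have h1 : ∀ᵐ τ ∂μ, ∀ᵐ u ∂m, ∃ n, k τ u ≤ k (η (n + n₁)) u := by
      filter_upwards [h₀] with τ hτ
      obtain ⟨n, hn⟩ := hηco τ hτ
      filter_upwards [H.coeff_le _ _ (hn.trans (hηmono (Nat.le_add_right n n₁)))] with u hu
      exact ⟨n, hu⟩
    have h2 := (Measure.ae_ae_comm (p := fun τ u => ∃ n, k τ u ≤ k (η (n + n₁)) u) hset).1 h1
    refine (Measure.ae_ae_comm (p := fun τ u => ∃ n, k (σ u τ) u ≤ k (η (n + n₁)) u) hset').2 ?_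
    filter_upwards [h2, H.preserving] with u hu hpu
    exact hpu.quasiMeasurePreserving.ae hu
  apply hne
  filter_upwards [hσ, hcof] with τ h1 h2
  obtain ⟨b, g, hg⟩ := h1
  by_contra hnz
  have hpos : 0 < jσ τ s := lt_of_le_of_ne (hg.nonneg hs) (Ne.symm hnz)
  obtain ⟨n, hn⟩ := (hg.isLive hpos).exists_lt_of_eventually_le H.s_pos H.mem
    (H.measurable_shuffled_section τ) (κ := fun n => k (η (n + n₁)))
    (fun n => H.measurable_section _) hmonoκ h2 hintg (j := fun n => j₀ (η (n + n₁)))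
    (fun n => hη _)
  exact hdead _ (hη _) hn

lemma tot_le (H : RankedShuffle μ m s r k σ)
    (h₀ : ∀ᵐ τ ∂μ, IsStopped m (k τ) s (j₀ τ))
    (hσ : ∀ᵐ τ ∂μ, IsStopped m (fun u => k (σ u τ) u) s (jσ τ)) {p : ℝ} (hp : 1 ≤ p) :
    Tot μ s p jσ ≤ Tot μ s p j₀ := by
  by_cases hlive : ∃ θ, IsStopped m (k θ) s (j₀ θ) ∧ 0 < j₀ θ s
  · exact H.tot_le_of_live h₀ hσ hlive hp
  · have hz := H.ae_eq_zero_of_dead h₀ hσ fun τ h1 h2 => hlive ⟨τ, h1, h2⟩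
    have : Tot μ s p jσ = 0 := by
      rw [Tot, lintegral_congr_ae (g := fun _ => 0), lintegral_zero]
      filter_upwards [hz] with τ hτ
      rw [hτ, Real.zero_rpow (by linarith), ENNReal.ofReal_zero]
    rw [this]
    exact zero_le

end RankedShuffle

/-- The rank of a member of a monotone family. -/
def rank (m : Measure ℝ) (k : T → ℝ → ℝ) (τ : T) : ℝ := ∫ u, Real.arctan (k τ u) ∂m

lemma measurable_rank {m : Measure ℝ} [SFinite m] {k : T → ℝ → ℝ}
    (hk : Measurable fun x : T × ℝ => k x.1 x.2) : Measurable (rank m k) :=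
  (StronglyMeasurable.integral_prod_right' (f := fun x : T × ℝ => Real.arctan (k x.1 x.2))
    (Real.measurable_arctan.comp hk).stronglyMeasurable).measurable

/-- `arctan` makes the integral finite while remaining strictly increasing. A strict reversal at one
time orders the members oppositely at all times; the rank inequality then forces equality almost
everywhere. -/
lemma IsMonotoneFamily.ae_le_of_rank_le {m : Measure ℝ} [IsFiniteMeasure m] {k : T → ℝ → ℝ} {t₀ : ℝ}
    (hmono : IsMonotoneFamily t₀ k) (hk : Measurable fun x : T × ℝ => k x.1 x.2)
    (hm : ∀ᵐ u ∂m, u ∈ Icc 0 t₀) {τ τ' : T} (h : rank m k τ ≤ rank m k τ') :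
    ∀ᵐ u ∂m, k τ u ≤ k τ' u := by
  by_cases hex : ∃ u ∈ Icc 0 t₀, k τ' u < k τ u
  · have hle := hmono τ τ' hex
    have hintg : ∀ τ, Integrable (fun u => Real.arctan (k τ u)) m := fun τ =>
      (integrable_const (Real.pi / 2)).mono'
        (Real.measurable_arctan.comp (hk.comp measurable_prodMk_left)).aestronglyMeasurable
        (Eventually.of_forall fun u => (Real.norm_eq_abs _).le.trans
          (abs_le.2 ⟨(Real.neg_pi_div_two_lt_arctan _).le, (Real.arctan_lt_pi_div_two _).le⟩))
    have hnn : 0 ≤ᵐ[m] fun u => Real.arctan (k τ u) - Real.arctan (k τ' u) := by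
      filter_upwards [hm] with u hu
      exact sub_nonneg.2 (Real.arctan_strictMono.monotone (hle u hu))
    have hzero : ∫ u, (Real.arctan (k τ u) - Real.arctan (k τ' u)) ∂m = 0 := by
      refine le_antisymm ?_ (integral_nonneg_of_ae hnn)
      rw [integral_sub (hintg τ) (hintg τ')]
      exact sub_nonpos.2 h
    have := (integral_eq_zero_iff_of_nonneg_ae hnn ((hintg τ).sub (hintg τ'))).1 hzero
    filter_upwards [this] with u hu
    exact (Real.arctan_injective (sub_eq_zero.1 hu)).le
  · push Not at hex
    filter_upwards [hm] with u hu using hex u hu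

theorem tot_shuffled_le {μ : Measure T} [IsProbabilityMeasure μ] {t₀ : ℝ} {σ : ℝ → T → T}
    (hσ : IsShuffle μ t₀ σ) {ν : Measure ℝ} [IsLocallyFiniteMeasure ν] {k : T → ℝ → ℝ}
    (hk : Measurable fun x : T × ℝ => k x.1 x.2) (hmono : IsMonotoneFamily t₀ k)
    {j₀ jσ : T → ℝ → ℝ} (h₀ : IsSolutionFamily μ ν t₀ k j₀)
    (h₁ : IsSolutionFamily μ ν t₀ (shuffled σ k) jσ) {s : ℝ} (hs : s ∈ Icc 0 t₀) {p : ℝ}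
    (hp : 1 ≤ p) : Tot μ s p jσ ≤ Tot μ s p j₀ := by
  -- At `s = 0` the shuffled solutions vanish; otherwise `ν` is restricted to `(0, s]`, where it is
  -- finite.
  rcases eq_or_lt_of_le hs.1 with rfl | hs0
  · have : Tot μ 0 p jσ = 0 := by
      rw [Tot, lintegral_congr_ae (g := fun _ => 0), lintegral_zero]
      filter_upwards [h₁] with τ hτ
      obtain ⟨b, hb, ⟨v, hv⟩, -⟩ := hτ
      rw [hv.position 0 ⟨le_rfl, hb.1.le⟩, intervalIntegral.integral_same,
        Real.zero_rpow (by linarith), ENNReal.ofReal_zero]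
    rw [this]
    exact zero_le
  have hsub : Ioc 0 s ⊆ Icc 0 t₀ := fun u hu => ⟨hu.1.le, hu.2.trans hs.2⟩
  have : IsFiniteMeasure (ν.restrict (Ioc 0 s)) :=
    ⟨by rw [Measure.restrict_apply_univ]; exact measure_Ioc_lt_top⟩
  have hmem : ∀ᵐ u ∂ν.restrict (Ioc 0 s), u ∈ Ioc 0 s := ae_restrict_mem measurableSet_Ioc
  have H : RankedShuffle μ (ν.restrict (Ioc 0 s)) s (rank (ν.restrict (Ioc 0 s)) k) k σ :=
    { s_pos := hs0
      mem := hmem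
      measurable_rank := measurable_rank hk
      measurable_coeff := hk
      coeff_le := fun τ τ' h => hmono.ae_le_of_rank_le hk (hmem.mono fun u hu => hsub hu) h
      measurable_shuffle := hσ.measurable
      preserving := hmem.mono fun u hu => hσ.preserving u (hsub hu) }
  exact H.tot_le (h₀.mono fun τ hτ => hτ.exists_stoppedAt ⟨hs0, hs.2⟩)
    (h₁.mono fun τ hτ => hτ.exists_stoppedAt ⟨hs0, hs.2⟩) hp

end Dead

end JacobiShuffle

end

theorem theorem1 {T : Type*} [MeasurableSpace T] (μ : MeasureTheory.Measure T)
    [MeasureTheory.IsProbabilityMeasure μ] (t₀ : ℝ) (σ : ℝ → T → T)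
    (hσ : JacobiShuffle.IsShuffle μ t₀ σ) :
    -- monotone families
    (∀ (ν : MeasureTheory.Measure ℝ) [MeasureTheory.IsLocallyFiniteMeasure ν] (k : T → ℝ → ℝ),
      Measurable (fun x : T × ℝ => k x.1 x.2) →
      JacobiShuffle.IsMonotoneFamily t₀ k →
      ∀ j₀ jσ : T → ℝ → ℝ,
        JacobiShuffle.IsSolutionFamily μ ν t₀ k j₀ →
        JacobiShuffle.IsSolutionFamily μ ν t₀ (JacobiShuffle.shuffled σ k) jσ →
        ∀ s ∈ Set.Icc 0 t₀, ∀ p : ℝ, 1 ≤ p →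
          JacobiShuffle.Tot μ s p jσ ≤ JacobiShuffle.Tot μ s p j₀) ∧
    -- constant coefficients
    (∀ c : T → ℝ, Measurable c →
      ∀ j₀ jσ : T → ℝ → ℝ,
        JacobiShuffle.IsSolutionFamily μ MeasureTheory.volume t₀ (fun τ _ => c τ) j₀ →
        JacobiShuffle.IsSolutionFamily μ MeasureTheory.volume t₀ (fun τ t => c (σ t τ)) jσ →
        ∀ s ∈ Set.Icc 0 t₀, ∀ p : ℝ, 1 ≤ p →
          JacobiShuffle.Tot μ s p jσ ≤ JacobiShuffle.Tot μ s p j₀) := by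
  refine ⟨fun ν _ k hk hmono j₀ jσ h₀ h₁ s hs p hp =>
    JacobiShuffle.tot_shuffled_le hσ hk hmono h₀ h₁ hs hp,
    fun c hc j₀ jσ h₀ h₁ s hs p hp => ?_⟩
  exact JacobiShuffle.tot_shuffled_le hσ (k := fun τ _ => c τ) (hc.comp measurable_fst)
    (fun _ _ ⟨_, _, h⟩ _ _ => h.le) h₀ h₁ hs hp
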